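/- For $n\in\mathbb N$ let $[n]=\{1,\dots,n\}$. A function $f:[n]\to\mathbb R$ is convex if $\frac{f(y)-f(x)}{y-x}\le\frac{f(z)-f(y)}{z-y}$ for all $x<y<z$ in $[n]$; it is $\varepsilon$-far from convex if every convex function $g:[n]\to\mathbb R$ satisfies $f(x)\ne g(x)$ for at least $\varepsilon n$ points $x\in[n]$. The number of distinct (discrete) derivatives of $f$ is the cardinality of $\{f(i+1)-f(i): 1\le i\le n-1\}$. An $\varepsilon$-tester for convexity of functions $f:[n]\to\mathbb R$ having at most $s$ distinct derivatives is a randomized, possibly adaptive, algorithm with oracle access to $f$ that, for every $f$ having at most $s$ distinct derivatives, accepts with probability at least $2/3$ if $f$ is convex and rejects with probability at least $2/3$ if $f$ is $\varepsilon$-far from convex. Its query complexity is the maximum number of oracle queries it makes, over all such $f$ and all outcomes of its random choices. Theorem. There is an absolute constant $c>0$ such that for every sufficiently large $s\in\mathbb N$, every $\varepsilon\in[1/s,1/9]$, and every sufficiently large $n\ge s$ (where how large $n$ has to be may depend on $s$ and $\varepsilon$), every $\varepsilon$-tester for convexity of functions $f:[n]\to\mathbb R$ having at most $s$ distinct derivatives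 has query complexity at least $c\cdot\frac{\log(\varepsilon s)}{\varepsilon}$. -/

import Mathlib

open MeasureTheory

/-- Convexity of `f : [n] → ℝ`: for all points `x < y < z` of the domain, the slope of `f` between
`x` and `y` is at most its slope between `y` and `z`. The domain `[n] = {1, …, n}` is
represented by `Fin n`. -/
def IsConvexFn {n : ℕ} (f : Fin n → ℝ) : Prop :=
  ∀ x y z : Fin n, x < y → y < z →
    (f y - f x) / ((y : ℝ) - (x : ℝ)) ≤ (f z - f y) / ((z : ℝ) - (y : ℝ))

/-- `f : [n] → ℝ` is `ε`-far from convex: every convex function on `[n]` evaluates differently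
from `f` on at least `ε n` points. -/
def IsFarFromConvex {n : ℕ} (ε : ℝ) (f : Fin n → ℝ) : Prop :=
  ∀ g : Fin n → ℝ, IsConvexFn g → ε * (n : ℝ) ≤ ({x : Fin n | f x ≠ g x}.ncard : ℝ)

/-- The derivative function `Δ_f : [n - 1] → ℝ`, `Δ_f(i) = f(i + 1) - f(i)`. -/
def discreteDerivative {n : ℕ} (f : Fin n → ℝ) (i : Fin (n - 1)) : ℝ :=
  f ⟨(i : ℕ) + 1, by omega⟩ - f ⟨(i : ℕ), by omega⟩

/-- The number of distinct discrete derivatives of `f`: the cardinality of the (finite) range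
of `Δ_f`. -/
noncomputable def numDistinctDerivatives {n : ℕ} (f : Fin n → ℝ) : ℕ :=
  (Set.range (discreteDerivative f)).ncard

/-- A deterministic adaptive query algorithm with oracle access to a function `[n] → ℝ`:
either it stops and accepts (`true`) or rejects (`false`), or it queries a point and
continues in an arbitrary way that depends on the answer (and on everything seen so far). -/
inductive QueryAlgorithm (n : ℕ) : Type
  | output (verdict : Bool) : QueryAlgorithm n
  | query (x : Fin n) (next : ℝ → QueryAlgorithm n) : QueryAlgorithm n

/-- The verdict (`true` for accept, `false` for reject) of a deterministic query algorithm
on input `f`. -/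
def QueryAlgorithm.run {n : ℕ} (f : Fin n → ℝ) : QueryAlgorithm n → Bool
  | .output b => b
  | .query x next => (next (f x)).run f

/-- The number of queries that a deterministic query algorithm makes on input `f`. -/
def QueryAlgorithm.queryCount {n : ℕ} (f : Fin n → ℝ) : QueryAlgorithm n → ℕ
  | .output _ => 0
  | .query x next => (next (f x)).queryCount f + 1

/-- A randomized (adaptive) query algorithm: a deterministic query algorithm chosen at random, the
random seed being drawn from an arbitrary probability space, such that on each fixed input the
verdict is a random variable. -/
structure RandomizedQueryAlgorithm (n : ℕ) where
  Seed : Type*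
  [measurableSpace : MeasurableSpace Seed]
  law : Measure Seed
  [isProbabilityMeasure : IsProbabilityMeasure law]
  alg : Seed → QueryAlgorithm n
  measurable_run : ∀ f : Fin n → ℝ, Measurable fun ω => (alg ω).run f

/-- The probability that a randomized query algorithm gives the verdict `b` on input `f`. -/
noncomputable def RandomizedQueryAlgorithm.prob {n : ℕ} (A : RandomizedQueryAlgorithm n)
    (f : Fin n → ℝ) (b : Bool) : ℝ :=
  (A.law {ω | (A.alg ω).run f = b}).toReal

/-- `A` is an `ε`-tester for convexity of functions `f : [n] → ℝ` having at most `s` distinct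
discrete derivatives: on each such function it accepts with probability at least `2/3` if the
function is convex, and rejects with probability at least `2/3` if it is `ε`-far from convex. -/
def IsConvexityTester {n : ℕ} (ε : ℝ) (s : ℕ) (A : RandomizedQueryAlgorithm n) : Prop :=
  ∀ f : Fin n → ℝ, numDistinctDerivatives f ≤ s →
    (IsConvexFn f → 2 / 3 ≤ A.prob f true) ∧
    (IsFarFromConvex ε f → 2 / 3 ≤ A.prob f false)

/-- `A` makes at most `q` queries, in the worst case over its random seed and over all inputs
`f : [n] → ℝ` with at most `s` distinct discrete derivatives. -/
def MakesAtMostQueries {n : ℕ} (s : ℕ) (A : RandomizedQueryAlgorithm n) (q : ℕ) : Prop :=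
  ∀ f : Fin n → ℝ, numDistinctDerivatives f ≤ s → ∀ ω : A.Seed, (A.alg ω).queryCount f ≤ q

/-!
The lower bound is proved by hiding one violation of convexity among `Ω(log (ε s) / ε)` places such
that `q` queries can inspect at most `3 q` of them.

**The inputs.** Cut `[n]` into `M` blocks of `l` points and a remainder of at most `l` points, where `M = B * 2 ^ L < s` consists of
`B ≈ 4 / (9 ε)` chunks of `2 ^ L` blocks. Every `i` in `[1, M]` is regarded as a node of the dyadic
tree: with `w` the largest power of two dividing `i`, its left half is `[i - w, i)` and its right half
is `[i, i + w)`. The function `hardFn` is piecewise linear on blocks, and its slope is a sum of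
contributions of nodes: node `i` contributes `z i / w` on its left half and `(z i + d i) / w` on its
right half. The integers `z i` and `d i` are uniform in ranges that grow so quickly with the level of
the node, namely `z i < T ^ (2 k + 2)` and `T ^ (2 k + 1) ≤ d i < 2 T ^ (2 k + 1)` at level `k`, that
the jump `d i` outweighs everything that happens at lower levels (`abs_blockSlope_sub_le`). Hence the
function is convex (`isConvexFn_hardFn`). If the sign of `d i` is reversed for all nodes `i` of one
class, that is, of one level in one chunk, then all slopes on the left half of such a node exceed
those on its right half, so a convex function disagrees with the input on almost all of one of the
halves, and the input is `ε`-far from convex (`isFarFromConvex_hardInput`). There are `(B - 1) L`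
classes with `B - 1 ≥ 2 / (9 ε)` and `2 ^ L ≥ ε s`; the first chunk is left out so that each node has
a neighbour at its left end.

**Indistinguishability.** Suppose that node `i` has queries in its left half, but none in its right
half or in the right half of the node `c = i + w` at its right end. Then reversing the jump of `i`,
which lowers the function on the right half of `i` and later, can be undone outside of the unqueried
region by increasing `d c` by `2 d i`. Symmetrically, if only the right half is queried, and the left
half of the node at the left end is not, then `z` and `d` at `i` and at that left node can be
adjusted; and if `i` is not queried at all, adding `d i` to `z i` suffices. In all other cases the
node is called `Caught`. So if no node of a class is caught, the parameters can be moved such that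
the function with reversed jumps agrees with the original one at all queries (`hardFn_transfer`). For
a fixed set of queries this move is injective. It changes `z i` by at most `2 d i`, and otherwise only
parameters of nodes of higher level, by `± 2 d i`, so that all shifts are tiny compared to the ranges
of the parameters that they affect: except near the boundary
of the parameter box, the box is preserved. As an adaptive deterministic algorithm follows the same
path on both inputs, it accepts nearly as many inputs with reversed jumps as convex ones
(`card_accept_le`).

**Counting.** A caught node is determined, up to three possibilities, by two consecutive queried
blocks `x < y`: it is the lowest common ancestor of `x` and `y`, or that of `x` and the last block
before this ancestor, or that of this ancestor's own block and `y`. So at most `3 q` classes are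
caught (`card_caught_classes_le`). Averaging over classes, parameters and the random seed
(`card_classes_le`) gives `3 q ≥ (1 / 3 - 1 / 25) (B - 1) L`.
-/

/-! ### Query sets of deterministic algorithms -/

/-- The set of points that a deterministic query algorithm queries on input `f`. -/
def QueryAlgorithm.querySet {n : ℕ} (f : Fin n → ℝ) : QueryAlgorithm n → Finset (Fin n)
  | .output _ => ∅
  | .query x next => insert x ((next (f x)).querySet f)

theorem QueryAlgorithm.card_querySet_le {n : ℕ} (f : Fin n → ℝ) (A : QueryAlgorithm n) :
    (A.querySet f).card ≤ A.queryCount f := by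
  induction A with
  | output b => simp [querySet, queryCount]
  | query x next ih =>
    simp only [querySet, queryCount]
    exact (Finset.card_insert_le _ _).trans (Nat.add_le_add_right (ih _) 1)

/-- A deterministic algorithm cannot tell apart two inputs that agree wherever it queries the first
one: it follows the same path on both. -/
theorem QueryAlgorithm.run_eq_of_eqOn {n : ℕ} {f g : Fin n → ℝ} (A : QueryAlgorithm n)
    (h : ∀ x ∈ A.querySet f, g x = f x) :
    A.run g = A.run f ∧ A.querySet g = A.querySet f := by
  induction A with
  | output b => simp [run, querySet]
  | query x next ih =>
    simp only [querySet, Finset.mem_insert, forall_eq_or_imp] at h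
    simp only [run, querySet, h.1]
    obtain ⟨h1, h2⟩ := ih _ h.2
    exact ⟨h1, by rw [h2]⟩

/-! ### Dyadic nodes -/

/-- The largest power of two dividing `i` (for `i ≠ 0`). The natural number `i` stands for the node
of the dyadic tree whose left half is the interval `[i - halfWidth i, i)` and whose right half
is `[i, i + halfWidth i)`. -/
def halfWidth (i : ℕ) : ℕ := 2 ^ padicValNat 2 i

theorem halfWidth_pos (i : ℕ) : 0 < halfWidth i := by unfold halfWidth; positivity

theorem halfWidth_dvd (i : ℕ) : halfWidth i ∣ i := pow_padicValNat_dvd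

theorem halfWidth_le {i : ℕ} (hi : i ≠ 0) : halfWidth i ≤ i :=
  Nat.le_of_dvd (Nat.pos_of_ne_zero hi) (halfWidth_dvd i)

theorem halfWidth_odd {i : ℕ} (hi : i ≠ 0) : ∃ m, i = halfWidth i * (2 * m + 1) := by
  obtain ⟨m, hm⟩ := halfWidth_dvd i
  rcases Nat.even_or_odd' m with ⟨t, rfl | rfl⟩
  · exfalso
    apply pow_succ_padicValNat_not_dvd (p := 2) hi
    rw [pow_succ]
    exact ⟨t, by rw [mul_assoc]; exact hm⟩
  · exact ⟨t, hm⟩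

theorem two_mul_halfWidth_not_dvd {i : ℕ} (hi : i ≠ 0) : ¬ 2 * halfWidth i ∣ i := by
  have := pow_succ_padicValNat_not_dvd (p := 2) hi
  rwa [pow_succ, mul_comm] at this

theorem halfWidth_dvd_of_le {i j : ℕ} (h : halfWidth i ≤ halfWidth j) :
    halfWidth i ∣ halfWidth j := by
  unfold halfWidth at *
  exact pow_dvd_pow _ ((Nat.pow_le_pow_iff_right (by norm_num)).1 h)

theorem two_mul_halfWidth_dvd_of_lt {i j : ℕ} (h : halfWidth i < halfWidth j) :
    2 * halfWidth i ∣ halfWidth j := by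
  unfold halfWidth at *
  have := (Nat.pow_lt_pow_iff_right (by norm_num : 1 < 2)).1 h
  rw [mul_comm, ← pow_succ]
  exact pow_dvd_pow _ this

theorem two_mul_halfWidth_dvd_add {i : ℕ} (hi : i ≠ 0) : 2 * halfWidth i ∣ i + halfWidth i := by
  obtain ⟨m, hm⟩ := halfWidth_odd hi
  exact ⟨m + 1, by nth_rewrite 1 [hm]; ring⟩

theorem two_mul_halfWidth_dvd_sub {i : ℕ} (hi : i ≠ 0) : 2 * halfWidth i ∣ i - halfWidth i := by
  obtain ⟨m, hm⟩ := halfWidth_odd hi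
  refine ⟨m, ?_⟩
  have : i = 2 * halfWidth i * m + halfWidth i := by nth_rewrite 1 [hm]; ring
  omega

theorem lt_halfWidth_of_dvd {w j : ℕ} (i : ℕ) (hw : w = halfWidth i) (hj : j ≠ 0)
    (h : 2 * w ∣ j) : w < halfWidth j := by
  by_contra hc
  push Not at hc
  subst hw
  exact two_mul_halfWidth_not_dvd hj ((mul_dvd_mul_left 2 (halfWidth_dvd_of_le hc)).trans h)

theorem halfWidth_lt_halfWidth_add {i : ℕ} (hi : i ≠ 0) :
    halfWidth i < halfWidth (i + halfWidth i) :=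
  lt_halfWidth_of_dvd i rfl (by omega) (two_mul_halfWidth_dvd_add hi)

theorem halfWidth_lt_halfWidth_sub {i : ℕ} (hi : i - halfWidth i ≠ 0) :
    halfWidth i < halfWidth (i - halfWidth i) :=
  lt_halfWidth_of_dvd i rfl hi (two_mul_halfWidth_dvd_sub (by omega))

/-- A multiple of `w` strictly inside the interval of radius `w` around another multiple of `w` is
its centre. -/
theorem eq_of_dvd_of_near {w i e : ℕ} (hi : w ∣ i) (he : w ∣ e) (h1 : i < e + w)
    (h2 : e < i + w) : e = i := by
  obtain ⟨a, rfl⟩ := hi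
  obtain ⟨b, rfl⟩ := he
  have h3 : a < b + 1 := by
    by_contra hc
    have := Nat.mul_le_mul_left w (not_lt.1 hc)
    rw [mul_add] at this; omega
  have h4 : b < a + 1 := by
    by_contra hc
    have := Nat.mul_le_mul_left w (not_lt.1 hc)
    rw [mul_add] at this; omega
  rw [show a = b by omega]

theorem padicValNat_lt_iff {i j : ℕ} :
    padicValNat 2 i < padicValNat 2 j ↔ halfWidth i < halfWidth j := by
  unfold halfWidth
  exact (Nat.pow_lt_pow_iff_right (by norm_num)).symm

/-! ### Ramps -/

/-- The function that vanishes up to the start of block `u`, rises with slope `1 / w` along the `w`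
blocks `u, …, u + w - 1` of `l` points each, and keeps the value `l` afterwards. -/
noncomputable def ramp (l u w x : ℕ) : ℝ := ((min (x - u * l) (w * l) : ℕ) : ℝ) / w

theorem ramp_eq_zero {l u w x : ℕ} (h : x ≤ u * l) : ramp l u w x = 0 := by
  simp [ramp, Nat.sub_eq_zero_of_le h]

theorem ramp_eq_top {l u w x : ℕ} (hw : 0 < w) (h : (u + w) * l ≤ x) : ramp l u w x = l := by
  have : w * l ≤ x - u * l := by rw [add_mul] at h; omega
  have hw' : (w : ℝ) ≠ 0 := by positivity
  rw [ramp, min_eq_right this]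
  push_cast
  field_simp

theorem ramp_succ_sub {l : ℕ} (hl : 0 < l) (u w x : ℕ) :
    ramp l u w (x + 1) - ramp l u w x = if u ≤ x / l ∧ x / l < u + w then 1 / (w : ℝ) else 0 := by
  have e1 : u ≤ x / l ↔ u * l ≤ x := Nat.le_div_iff_mul_le hl
  have e2 : x / l < u + w ↔ x < u * l + w * l := by
    rw [Nat.div_lt_iff_lt_mul hl, add_mul]
  simp only [e1, e2]
  unfold ramp
  rw [← sub_div]
  split_ifs with h
  · congr 1
    rw [min_eq_left (by omega), min_eq_left (by omega), Nat.sub_add_comm h.1]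
    push_cast; ring
  · have : min (x + 1 - u * l) (w * l) = min (x - u * l) (w * l) := by omega
    rw [this]; simp

/-- The ramp along the left half of node `i`. There is no node `0`. -/
noncomputable def leftRamp (l i x : ℕ) : ℝ :=
  if i = 0 then 0 else ramp l (i - halfWidth i) (halfWidth i) x

/-- The ramp along the right half of node `i`. There is no node `0`. -/
noncomputable def rightRamp (l i x : ℕ) : ℝ :=
  if i = 0 then 0 else ramp l i (halfWidth i) x

/-- The slope of `leftRamp l i` in block `j`. -/
noncomputable def leftSlope (i j : ℕ) : ℝ :=
  if i ≠ 0 ∧ i - halfWidth i ≤ j ∧ j < i then 1 / (halfWidth i : ℝ) else 0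

/-- The slope of `rightRamp l i` in block `j`. -/
noncomputable def rightSlope (i j : ℕ) : ℝ :=
  if i ≠ 0 ∧ i ≤ j ∧ j < i + halfWidth i then 1 / (halfWidth i : ℝ) else 0

theorem leftRamp_succ_sub {l : ℕ} (hl : 0 < l) (i x : ℕ) :
    leftRamp l i (x + 1) - leftRamp l i x = leftSlope i (x / l) := by
  unfold leftRamp leftSlope
  by_cases hi : i = 0
  · simp [hi]
  · rw [if_neg hi, if_neg hi, ramp_succ_sub hl, Nat.sub_add_cancel (halfWidth_le hi)]
    simp [hi]

theorem rightRamp_succ_sub {l : ℕ} (hl : 0 < l) (i x : ℕ) :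
    rightRamp l i (x + 1) - rightRamp l i x = rightSlope i (x / l) := by
  unfold rightRamp rightSlope
  by_cases hi : i = 0
  · simp [hi]
  · rw [if_neg hi, if_neg hi, ramp_succ_sub hl]
    simp [hi]

/-! ### The hard functions -/

/-- The sign of the slope jump at node `i`: negative exactly on the set `κ` of violated nodes. -/
def jumpSign (κ : Finset ℕ) (i : ℕ) : ℝ := if i ∈ κ then -1 else 1

/-- The piecewise linear function with blocks of `l` points in which node `i ≤ M` contributes the
slope `z i / halfWidth i` on its left half and `(z i ± d i) / halfWidth i` on its right half, the
sign being negative for the nodes of `κ`. -/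
noncomputable def hardFn {M : ℕ} (l : ℕ) (κ : Finset ℕ) (z d : Fin (M + 1) → ℤ) (x : ℕ) : ℝ :=
  ∑ i : Fin (M + 1), ((z i : ℝ) * leftRamp l i x + (z i + jumpSign κ i * d i) * rightRamp l i x)

/-- The contribution of node `i` to the slope of `hardFn` in block `j`. -/
noncomputable def nodeSlope {M : ℕ} (κ : Finset ℕ) (z d : Fin (M + 1) → ℤ) (j : ℕ)
    (i : Fin (M + 1)) : ℝ :=
  (z i : ℝ) * leftSlope i j + (z i + jumpSign κ i * d i) * rightSlope i j

/-- The slope of `hardFn` in block `j`. -/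
noncomputable def blockSlope {M : ℕ} (κ : Finset ℕ) (z d : Fin (M + 1) → ℤ) (j : ℕ) : ℝ :=
  ∑ i : Fin (M + 1), nodeSlope κ z d j i

theorem hardFn_succ_sub {M l : ℕ} (hl : 0 < l) (κ : Finset ℕ) (z d : Fin (M + 1) → ℤ) (x : ℕ) :
    hardFn l κ z d (x + 1) - hardFn l κ z d x = blockSlope κ z d (x / l) := by
  unfold hardFn blockSlope nodeSlope
  rw [← Finset.sum_sub_distrib]
  refine Finset.sum_congr rfl fun i _ => ?_
  rw [← leftRamp_succ_sub hl, ← rightRamp_succ_sub hl]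
  ring

/-- The range of the parameters `z`: the node `i` of level `k` takes all values in
`[0, T ^ (2 k + 2))`. -/
noncomputable def shiftRange (T : ℤ) (i : ℕ) : Finset ℤ := Finset.Ico 0 (T ^ (2 * padicValNat 2 i + 2))

/-- The range of the parameters `d`: the node `i` of level `k` takes all values in
`[T ^ (2 k + 1), 2 T ^ (2 k + 1))`. -/
noncomputable def jumpRange (T : ℤ) (i : ℕ) : Finset ℤ :=
  Finset.Ico (T ^ (2 * padicValNat 2 i + 1)) (2 * T ^ (2 * padicValNat 2 i + 1))

/-- The set of all parameter pairs `(z, d)`. -/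
noncomputable def paramBox (M : ℕ) (T : ℤ) : Finset ((Fin (M + 1) → ℤ) × (Fin (M + 1) → ℤ)) :=
  (Fintype.piFinset fun i : Fin (M + 1) => shiftRange T i) ×ˢ
    (Fintype.piFinset fun i : Fin (M + 1) => jumpRange T i)

theorem mem_paramBox {M : ℕ} {T : ℤ} {p : (Fin (M + 1) → ℤ) × (Fin (M + 1) → ℤ)} :
    p ∈ paramBox M T ↔
      (∀ i : Fin (M + 1), 0 ≤ p.1 i ∧ p.1 i < T ^ (2 * padicValNat 2 i + 2)) ∧
      (∀ i : Fin (M + 1), T ^ (2 * padicValNat 2 i + 1) ≤ p.2 i ∧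
        p.2 i < 2 * T ^ (2 * padicValNat 2 i + 1)) := by
  simp [paramBox, shiftRange, jumpRange, Fintype.mem_piFinset]

theorem abs_nodeSlope_le {M : ℕ} (κ : Finset ℕ) (z d : Fin (M + 1) → ℤ) (j : ℕ)
    (i : Fin (M + 1)) (hz : 0 ≤ z i) (hd : 0 ≤ d i) :
    |nodeSlope κ z d j i| ≤ z i + d i := by
  have hz' : (0 : ℝ) ≤ z i := by exact_mod_cast hz
  have hd' : (0 : ℝ) ≤ d i := by exact_mod_cast hd
  have hw : (1 : ℝ) ≤ halfWidth i := by exact_mod_cast halfWidth_pos i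
  have hw1 : 1 / (halfWidth i : ℝ) ≤ 1 := by rw [div_le_one (by linarith)]; exact hw
  have hw0 : 0 ≤ 1 / (halfWidth i : ℝ) := by positivity
  have key : |(z i : ℝ) + jumpSign κ i * d i| ≤ z i + d i := by
    unfold jumpSign
    split_ifs <;> rw [abs_le] <;> constructor <;> linarith
  have mul_le : ∀ {a b t : ℝ}, |a| ≤ b → 0 ≤ b → 0 ≤ t → t ≤ 1 → |a * t| ≤ b := by
    intro a b t h hb h0 h1
    rw [abs_mul, abs_of_nonneg h0]
    nlinarith
  unfold nodeSlope leftSlope rightSlope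
  split_ifs with h1 h2 h2
  · omega
  · rw [mul_zero, add_zero]
    exact mul_le (by rw [abs_of_nonneg hz']; linarith) (by linarith) hw0 hw1
  · rw [mul_zero, zero_add]
    exact mul_le key (by linarith) hw0 hw1
  · simp; linarith

/-- A node other than `i₀` whose half-width is at least that of `i₀` is constant across the interval
of `i₀`. -/
theorem nodeSlope_eq_of_le {M : ℕ} (κ : Finset ℕ) (z d : Fin (M + 1) → ℤ) {i₀ j j' : ℕ}
    (hi₀ : i₀ ≠ 0) (h1 : i₀ - halfWidth i₀ ≤ j) (h2 : j < i₀) (h3 : i₀ ≤ j')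
    (h4 : j' < i₀ + halfWidth i₀) (i : Fin (M + 1)) (hi : (i : ℕ) ≠ i₀)
    (hw : halfWidth i₀ ≤ halfWidth i) : nodeSlope κ z d j i = nodeSlope κ z d j' i := by
  by_cases hi0 : (i : ℕ) = 0
  · simp [nodeSlope, leftSlope, rightSlope, hi0]
  have hle := halfWidth_le hi₀
  have hle' := halfWidth_le hi0
  have hdvd := halfWidth_dvd_of_le hw
  -- No endpoint of the two halves of `i` lies in `(j, j']`, since it would have to be `i₀`.
  have endpoint : ∀ e, e ≠ i₀ → halfWidth i₀ ∣ e → (e ≤ j ↔ e ≤ j') := by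
    intro e he hed
    constructor
    · omega
    · intro h
      by_contra hc
      exact he (eq_of_dvd_of_near (halfWidth_dvd i₀) hed (by omega) (by omega))
  have ne_of : ∀ e, 2 * halfWidth i ∣ e → e ≠ i₀ := by
    rintro e he rfl
    exact two_mul_halfWidth_not_dvd hi₀ ((mul_dvd_mul_left 2 hdvd).trans he)
  have ea := endpoint _ (ne_of _ (two_mul_halfWidth_dvd_sub hi0))
    (hdvd.trans ((Dvd.intro_left 2 rfl).trans (two_mul_halfWidth_dvd_sub hi0)))
  have eb := endpoint i hi (hdvd.trans (halfWidth_dvd _))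
  have ec := endpoint _ (ne_of _ (two_mul_halfWidth_dvd_add hi0))
    (hdvd.trans ((Dvd.intro_left 2 rfl).trans (two_mul_halfWidth_dvd_add hi0)))
  have h5 : leftSlope i j = leftSlope i j' := by
    unfold leftSlope
    congr 1
    apply propext
    omega
  have h6 : rightSlope i j = rightSlope i j' := by
    unfold rightSlope
    congr 1
    apply propext
    omega
  rw [nodeSlope, nodeSlope, h5, h6]

/-- Across node `i₀`, the slope changes by the jump of `i₀` up to an error that comes from the nodes
of lower level. -/
theorem abs_blockSlope_sub_le {M : ℕ} {T : ℤ} (hT : 2 ≤ T) (κ : Finset ℕ)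
    {p : (Fin (M + 1) → ℤ) × (Fin (M + 1) → ℤ)} (hp : p ∈ paramBox M T) {j j' : ℕ}
    (i₀ : Fin (M + 1)) (hi₀ : (i₀ : ℕ) ≠ 0) (h1 : i₀ - halfWidth i₀ ≤ j) (h2 : j < i₀)
    (h3 : i₀ ≤ j') (h4 : j' < i₀ + halfWidth i₀) :
    |blockSlope κ p.1 p.2 j' - blockSlope κ p.1 p.2 j - jumpSign κ i₀ * p.2 i₀ / halfWidth i₀| ≤
      (M + 1) * (4 * (T : ℝ) ^ (2 * padicValNat 2 i₀)) := by
  obtain ⟨hz, hd⟩ := mem_paramBox.1 hp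
  have hT' : (2 : ℝ) ≤ T := by exact_mod_cast hT
  have hT0 : (0 : ℤ) ≤ T := by omega
  have hd0 : ∀ i, 0 ≤ p.2 i := fun i => (pow_nonneg hT0 _).trans (hd i).1
  have e : blockSlope κ p.1 p.2 j' - blockSlope κ p.1 p.2 j -
      jumpSign κ i₀ * p.2 i₀ / halfWidth i₀ =
      ∑ i : Fin (M + 1), (nodeSlope κ p.1 p.2 j' i - nodeSlope κ p.1 p.2 j i -
        if i = i₀ then jumpSign κ i₀ * p.2 i₀ / halfWidth i₀ else 0) := by
    rw [Finset.sum_sub_distrib, Finset.sum_sub_distrib, Finset.sum_ite_eq' Finset.univ i₀]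
    simp [blockSlope]
  rw [e]
  refine (Finset.abs_sum_le_sum_abs _ _).trans ?_
  have card : ((Finset.univ : Finset (Fin (M + 1))).card : ℝ) = M + 1 := by simp
  rw [← card, ← nsmul_eq_mul]
  refine Finset.sum_le_card_nsmul _ _ _ fun i _ => ?_
  have hR : 0 ≤ 4 * (T : ℝ) ^ (2 * padicValNat 2 i₀) := by positivity
  by_cases hi : i = i₀
  · subst hi
    rw [if_pos rfl]
    have : nodeSlope κ p.1 p.2 j' i - nodeSlope κ p.1 p.2 j i -
        jumpSign κ i * p.2 i / halfWidth i = 0 := by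
      unfold nodeSlope leftSlope rightSlope
      rw [if_neg (by omega), if_pos ⟨hi₀, h3, h4⟩, if_pos ⟨hi₀, h1, h2⟩, if_neg (by omega)]
      ring
    rw [this]; simpa using hR
  · rw [if_neg hi, sub_zero]
    have hi' : (i : ℕ) ≠ i₀ := fun h => hi (Fin.ext h)
    rcases le_or_gt (halfWidth i₀) (halfWidth i) with hw | hw
    · rw [nodeSlope_eq_of_le κ p.1 p.2 hi₀ h1 h2 h3 h4 i hi' hw]; simpa using hR
    · have hlt := padicValNat_lt_iff.2 hw
      have hb : (p.1 i : ℝ) + p.2 i ≤ 2 * (T : ℝ) ^ (2 * padicValNat 2 i₀) := by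
        have b1 : (p.1 i : ℝ) ≤ (T : ℝ) ^ (2 * padicValNat 2 i + 2) := by
          exact_mod_cast (hz i).2.le
        have b2 : (p.2 i : ℝ) ≤ 2 * (T : ℝ) ^ (2 * padicValNat 2 i + 1) := by
          exact_mod_cast (hd i).2.le
        have b3 : 2 * (T : ℝ) ^ (2 * padicValNat 2 i + 1) ≤ (T : ℝ) ^ (2 * padicValNat 2 i + 2) := by
          rw [pow_succ _ (2 * padicValNat 2 i + 1), mul_comm]
          exact mul_le_mul_of_nonneg_left hT' (by positivity)
        have b4 : (T : ℝ) ^ (2 * padicValNat 2 i + 2) ≤ (T : ℝ) ^ (2 * padicValNat 2 i₀) :=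
          pow_le_pow_right₀ (by linarith) (by omega)
        linarith
      have := abs_sub (nodeSlope κ p.1 p.2 j' i) (nodeSlope κ p.1 p.2 j i)
      have c1 := abs_nodeSlope_le κ p.1 p.2 j' i (hz i).1 (hd0 i)
      have c2 := abs_nodeSlope_le κ p.1 p.2 j i (hz i).1 (hd0 i)
      linarith

/-! ### Convexity -/

theorem sub_le_of_forall_succ_sub_le {F : ℕ → ℝ} {c : ℝ} {x y : ℕ} (hxy : x ≤ y)
    (h : ∀ t, x ≤ t → t < y → F (t + 1) - F t ≤ c) : F y - F x ≤ c * ((y : ℝ) - x) := by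
  induction y, hxy using Nat.le_induction with
  | base => simp
  | succ y hxy ih =>
    have h1 := ih fun t h1 h2 => h t h1 (by omega)
    have h2 := h y hxy (by omega)
    push_cast
    linarith

theorem le_sub_of_forall_le_succ_sub {F : ℕ → ℝ} {c : ℝ} {x y : ℕ} (hxy : x ≤ y)
    (h : ∀ t, x ≤ t → t < y → c ≤ F (t + 1) - F t) : c * ((y : ℝ) - x) ≤ F y - F x := by
  induction y, hxy using Nat.le_induction with
  | base => simp
  | succ y hxy ih =>
    have h1 := ih fun t h1 h2 => h t h1 (by omega)
    have h2 := h y hxy (by omega)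
    push_cast
    linarith

theorem isConvexFn_of_succ_sub_mono {n : ℕ} {F : ℕ → ℝ}
    (h : ∀ x y, x ≤ y → y + 1 < n → F (x + 1) - F x ≤ F (y + 1) - F y) :
    IsConvexFn fun x : Fin n => F x := by
  intro x y z hxy hyz
  have hxy' : (x : ℕ) < y := hxy
  have hyz' : (y : ℕ) < z := hyz
  have hz := z.2
  have h1 := sub_le_of_forall_succ_sub_le (F := F) (c := F (y + 1) - F y) hxy'.le
    fun t _ ht => h t y ht.le (by omega)
  have h2 := le_sub_of_forall_le_succ_sub (F := F) (c := F (y + 1) - F y) hyz'.le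
    fun t ht ht' => h y t ht (by omega)
  have h3 : (0 : ℝ) < (y : ℝ) - x := by rw [sub_pos]; exact_mod_cast hxy'
  have h4 : (0 : ℝ) < (z : ℝ) - y := by rw [sub_pos]; exact_mod_cast hyz'
  exact ((div_le_iff₀ h3).2 h1).trans ((le_div_iff₀ h4).2 h2)

/-- The jump at a node outweighs the contributions of all nodes of lower level. -/
theorem lower_levels_lt_jump {M : ℕ} {T : ℤ} (hT : 4 * ((M : ℤ) + 1) ^ 2 ≤ T)
    {p : (Fin (M + 1) → ℤ) × (Fin (M + 1) → ℤ)} (hp : p ∈ paramBox M T) (i : Fin (M + 1))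
    (hi : (i : ℕ) ≠ 0) :
    (M + 1) * (4 * (T : ℝ) ^ (2 * padicValNat 2 i)) < p.2 i / halfWidth i := by
  have hd := ((mem_paramBox.1 hp).2 i).1
  have hd' : (T : ℝ) ^ (2 * padicValNat 2 i + 1) ≤ p.2 i := by exact_mod_cast hd
  have hT' : 4 * ((M : ℝ) + 1) ^ 2 ≤ T := by exact_mod_cast hT
  have hw0 : (0 : ℝ) < halfWidth i := by exact_mod_cast halfWidth_pos i
  have hwM : (halfWidth i : ℝ) < M + 1 := by
    have := halfWidth_le hi
    exact_mod_cast (by omega : halfWidth i < M + 1)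
  have hM : (0 : ℝ) < (M : ℝ) + 1 := by positivity
  have hT0 : (0 : ℝ) < T := by nlinarith
  have hR : 0 < (T : ℝ) ^ (2 * padicValNat 2 i) := by positivity
  rw [lt_div_iff₀ hw0]
  rw [pow_succ] at hd'
  calc (M + 1) * (4 * (T : ℝ) ^ (2 * padicValNat 2 i)) * halfWidth i
      < (M + 1) * (4 * (T : ℝ) ^ (2 * padicValNat 2 i)) * (M + 1) := by gcongr
    _ = (T : ℝ) ^ (2 * padicValNat 2 i) * (4 * ((M : ℝ) + 1) ^ 2) := by ring
    _ ≤ (T : ℝ) ^ (2 * padicValNat 2 i) * T := by gcongr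
    _ ≤ p.2 i := hd'

theorem two_le_of_sq_le {M : ℕ} {T : ℤ} (hT : 4 * ((M : ℤ) + 1) ^ 2 ≤ T) : 2 ≤ T := by
  nlinarith [Int.natCast_nonneg M]

theorem blockSlope_lt_of_notMem {M : ℕ} {T : ℤ} (hT : 4 * ((M : ℤ) + 1) ^ 2 ≤ T) (κ : Finset ℕ)
    {p : (Fin (M + 1) → ℤ) × (Fin (M + 1) → ℤ)} (hp : p ∈ paramBox M T) {j j' : ℕ}
    (i : Fin (M + 1)) (hi : (i : ℕ) ≠ 0) (hκ : (i : ℕ) ∉ κ) (h1 : i - halfWidth i ≤ j) (h2 : j < i)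
    (h3 : i ≤ j') (h4 : j' < i + halfWidth i) :
    blockSlope κ p.1 p.2 j < blockSlope κ p.1 p.2 j' := by
  have h := abs_blockSlope_sub_le (two_le_of_sq_le hT) κ hp i hi h1 h2 h3 h4
  have h' := lower_levels_lt_jump hT hp i hi
  rw [jumpSign, if_neg hκ, one_mul] at h
  have := (abs_le.1 h).1
  linarith

theorem blockSlope_lt_of_mem {M : ℕ} {T : ℤ} (hT : 4 * ((M : ℤ) + 1) ^ 2 ≤ T) (κ : Finset ℕ)
    {p : (Fin (M + 1) → ℤ) × (Fin (M + 1) → ℤ)} (hp : p ∈ paramBox M T) {j j' : ℕ}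
    (i : Fin (M + 1)) (hi : (i : ℕ) ≠ 0) (hκ : (i : ℕ) ∈ κ) (h1 : i - halfWidth i ≤ j) (h2 : j < i)
    (h3 : i ≤ j') (h4 : j' < i + halfWidth i) :
    blockSlope κ p.1 p.2 j' < blockSlope κ p.1 p.2 j := by
  have h := abs_blockSlope_sub_le (two_le_of_sq_le hT) κ hp i hi h1 h2 h3 h4
  have h' := lower_levels_lt_jump hT hp i hi
  rw [jumpSign, if_pos hκ, neg_one_mul, neg_div] at h
  have := (abs_le.1 h).2
  linarith

theorem blockSlope_empty_mono {M : ℕ} {T : ℤ} (hT : 4 * ((M : ℤ) + 1) ^ 2 ≤ T)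
    {p : (Fin (M + 1) → ℤ) × (Fin (M + 1) → ℤ)} (hp : p ∈ paramBox M T) {j j' : ℕ}
    (hjj : j ≤ j') (hj' : j' ≤ M) : blockSlope ∅ p.1 p.2 j ≤ blockSlope ∅ p.1 p.2 j' := by
  induction j', hjj using Nat.le_induction with
  | base => exact le_rfl
  | succ t _ ih =>
    refine (ih (by omega)).trans (le_of_lt ?_)
    have := halfWidth_pos (t + 1)
    exact blockSlope_lt_of_notMem hT ∅ hp ⟨t + 1, by omega⟩ (by simp) (by simp)
      (by simp only; omega) (by simp) (by simp) (by simpa using this)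

theorem isConvexFn_hardFn {M n l : ℕ} {T : ℤ} (hT : 4 * ((M : ℤ) + 1) ^ 2 ≤ T) (hl : 0 < l)
    (hn : n ≤ (M + 1) * l) {p : (Fin (M + 1) → ℤ) × (Fin (M + 1) → ℤ)} (hp : p ∈ paramBox M T) :
    IsConvexFn fun x : Fin n => hardFn l ∅ p.1 p.2 x := by
  refine isConvexFn_of_succ_sub_mono (F := hardFn l ∅ p.1 p.2) fun x y hxy hy => ?_
  rw [hardFn_succ_sub hl, hardFn_succ_sub hl]
  refine blockSlope_empty_mono hT hp (Nat.div_le_div_right hxy) ?_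
  have : y / l < M + 1 := (Nat.div_lt_iff_lt_mul hl).2 (by omega)
  omega

/-! ### Distinct derivatives -/

theorem numDistinctDerivatives_hardFn_le {M n l : ℕ} (hl : 0 < l) (hn : n ≤ (M + 1) * l)
    (κ : Finset ℕ) (z d : Fin (M + 1) → ℤ) :
    numDistinctDerivatives (fun x : Fin n => hardFn l κ z d x) ≤ M + 1 := by
  have hsub : Set.range (discreteDerivative fun x : Fin n => hardFn l κ z d x) ⊆
      ((Finset.range (M + 1)).image (blockSlope κ z d) : Finset ℝ) := by
    rintro _ ⟨i, rfl⟩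
    have hi := i.2
    rw [Finset.coe_image]
    refine ⟨i / l, ?_, ?_⟩
    · simp only [Finset.coe_range, Set.mem_Iio]
      exact (Nat.div_lt_iff_lt_mul hl).2 (by omega)
    · simp only [discreteDerivative]
      rw [hardFn_succ_sub hl]
  refine (Set.ncard_le_ncard hsub (Finset.finite_toSet _)).trans ?_
  rw [Set.ncard_coe_finset]
  exact Finset.card_image_le.trans (by simp)

/-! ### Distance from convexity -/

theorem card_filter_fin_interval {n a b : ℕ} (hb : b ≤ n) :
    (Finset.univ.filter fun x : Fin n => a ≤ (x : ℕ) ∧ (x : ℕ) < b).card = b - a := by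
  rw [← Nat.card_Ico, ← Finset.card_map Fin.valEmbedding]
  congr 1
  ext y
  simp only [Finset.mem_map, Finset.mem_filter, Finset.mem_univ, true_and, Fin.valEmbedding_apply,
    Finset.mem_Ico]
  constructor
  · rintro ⟨x, hx, rfl⟩; exact hx
  · intro hy; exact ⟨⟨y, by omega⟩, hy, rfl⟩

/-- If all slopes of `F` on `[a, b)` exceed all its slopes on `[b, c)`, a convex function cannot
agree with `F` at two points of `[a, b)` and at two points of `[b, c)`. -/
theorem not_two_agreements {n a b c : ℕ} {F : ℕ → ℝ} {u v : ℝ} (huv : v < u)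
    (hL : ∀ t, a ≤ t → t + 1 < b → u ≤ F (t + 1) - F t)
    (hR : ∀ t, b ≤ t → t + 1 < c → F (t + 1) - F t ≤ v) {g : Fin n → ℝ} (hg : IsConvexFn g)
    {x₁ x₂ x₃ x₄ : Fin n} (h1 : a ≤ x₁) (h12 : x₁ < x₂) (h2 : x₂ < b) (h3 : b ≤ x₃) (h34 : x₃ < x₄)
    (h4 : x₄ < c) (e1 : F x₁ = g x₁) (e2 : F x₂ = g x₂) (e3 : F x₃ = g x₃) (e4 : F x₄ = g x₄) :
    False := by
  have h12' : (x₁ : ℕ) < x₂ := h12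
  have h34' : (x₃ : ℕ) < x₄ := h34
  have h23 : x₂ < x₃ := by rw [Fin.lt_def]; omega
  have k1 := hg x₁ x₂ x₃ h12 h23
  have k2 := hg x₂ x₃ x₄ h23 h34
  have p1 : (0 : ℝ) < (x₂ : ℝ) - x₁ := by rw [sub_pos]; exact_mod_cast h12'
  have p2 : (0 : ℝ) < (x₄ : ℝ) - x₃ := by rw [sub_pos]; exact_mod_cast h34'
  have q1 := le_sub_of_forall_le_succ_sub (F := F) (c := u) h12'.le
    fun t ht ht' => hL t (by omega) (by omega)
  have q2 := sub_le_of_forall_succ_sub_le (F := F) (c := v) h34'.le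
    fun t ht ht' => hR t (by omega) (by omega)
  rw [← le_div_iff₀ p1, e1, e2] at q1
  rw [← div_le_iff₀ p2, e3, e4] at q2
  linarith

/-- A convex function differs from `hardFn` in all but one point of one of the two halves of each
violated node. -/
theorem le_card_disagreement_node {M n l : ℕ} {T : ℤ} (hT : 4 * ((M : ℤ) + 1) ^ 2 ≤ T) (hl : 0 < l)
    (κ : Finset ℕ) {p : (Fin (M + 1) → ℤ) × (Fin (M + 1) → ℤ)} (hp : p ∈ paramBox M T)
    (i : Fin (M + 1)) (hi : (i : ℕ) ≠ 0) (hκ : (i : ℕ) ∈ κ) (hin : (i + halfWidth i) * l ≤ n)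
    {g : Fin n → ℝ} (hg : IsConvexFn g) :
    halfWidth i * l - 1 ≤ (Finset.univ.filter fun x : Fin n => hardFn l κ p.1 p.2 x ≠ g x ∧
      ((i - halfWidth i) * l ≤ (x : ℕ) ∧ (x : ℕ) < (i + halfWidth i) * l)).card := by
  set w := halfWidth i with hw
  have hw0 : 0 < w := halfWidth_pos i
  have hwi : w ≤ i := halfWidth_le hi
  set F := hardFn l κ p.1 p.2 with hF
  obtain ⟨jL, hjL, hjL'⟩ := Finset.exists_min_image (Finset.Ico (i - w : ℕ) i)
    (blockSlope κ p.1 p.2) ⟨i - w, Finset.mem_Ico.2 ⟨le_rfl, by omega⟩⟩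
  obtain ⟨jR, hjR, hjR'⟩ := Finset.exists_max_image (Finset.Ico (i : ℕ) (i + w))
    (blockSlope κ p.1 p.2) ⟨i, Finset.mem_Ico.2 ⟨le_rfl, by omega⟩⟩
  rw [Finset.mem_Ico] at hjL hjR
  have huv := blockSlope_lt_of_mem hT κ hp i hi hκ hjL.1 hjL.2 hjR.1 hjR.2
  have eL : (i - w) * l + w * l = i * l := by rw [← add_mul, Nat.sub_add_cancel hwi]
  have eR : (i + w) * l = i * l + w * l := add_mul _ _ _
  have hL : ∀ t, (i - w) * l ≤ t → t + 1 < i * l → blockSlope κ p.1 p.2 jL ≤ F (t + 1) - F t := by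
    intro t h1 h2
    rw [hF, hardFn_succ_sub hl]
    exact hjL' _ (Finset.mem_Ico.2 ⟨(Nat.le_div_iff_mul_le hl).2 h1,
      (Nat.div_lt_iff_lt_mul hl).2 (by omega)⟩)
  have hR : ∀ t, i * l ≤ t → t + 1 < (i + w) * l →
      F (t + 1) - F t ≤ blockSlope κ p.1 p.2 jR := by
    intro t h1 h2
    rw [hF, hardFn_succ_sub hl]
    exact hjR' _ (Finset.mem_Ico.2 ⟨(Nat.le_div_iff_mul_le hl).2 h1,
      (Nat.div_lt_iff_lt_mul hl).2 (by omega)⟩)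
  -- A half `[a, b)` with at most one agreement consists of disagreements up to one point.
  have half : ∀ a b : ℕ, b = a + w * l → (i - w) * l ≤ a → b ≤ (i + w) * l →
      ((Finset.univ.filter fun x : Fin n => a ≤ (x : ℕ) ∧ (x : ℕ) < b).filter
        fun x : Fin n => F x = g x).card ≤ 1 →
      w * l - 1 ≤ (Finset.univ.filter fun x : Fin n => F x ≠ g x ∧
        ((i - w) * l ≤ (x : ℕ) ∧ (x : ℕ) < (i + w) * l)).card := by
    intro a b hb ha hb' hc
    have h1 := Finset.card_filter_add_card_filter_not
      (s := Finset.univ.filter fun x : Fin n => a ≤ (x : ℕ) ∧ (x : ℕ) < b) (fun x : Fin n => F x = g x)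
    rw [card_filter_fin_interval (hb'.trans hin)] at h1
    refine le_trans (by omega) (Finset.card_le_card (s := (Finset.univ.filter fun x : Fin n =>
      a ≤ (x : ℕ) ∧ (x : ℕ) < b).filter fun x : Fin n => ¬ F x = g x) ?_)
    intro x hx
    simp only [Finset.mem_filter, Finset.mem_univ, true_and] at hx ⊢
    exact ⟨hx.2, by omega, by omega⟩
  by_contra hcon
  have hA := mt (half ((i - w) * l) (i * l) eL.symm le_rfl (by omega)) hcon
  have hB := mt (half (i * l) ((i + w) * l) eR (by omega) le_rfl) hcon
  rw [not_le, Finset.one_lt_card] at hA hB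
  -- Two agreements in each half, in increasing order, contradict convexity.
  have ordered : ∀ a b : ℕ, (∃ x ∈ (Finset.univ.filter fun x : Fin n =>
      a ≤ (x : ℕ) ∧ (x : ℕ) < b).filter fun x : Fin n => F x = g x,
      ∃ y ∈ (Finset.univ.filter fun x : Fin n =>
      a ≤ (x : ℕ) ∧ (x : ℕ) < b).filter fun x : Fin n => F x = g x, x ≠ y) →
      ∃ x y : Fin n, x < y ∧ a ≤ (x : ℕ) ∧ (y : ℕ) < b ∧ F x = g x ∧ F y = g y := by
    rintro a b ⟨x, hx, y, hy, hxy⟩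
    simp only [Finset.mem_filter, Finset.mem_univ, true_and] at hx hy
    rcases lt_or_gt_of_ne hxy with h | h
    · exact ⟨x, y, h, hx.1.1, hy.1.2, hx.2, hy.2⟩
    · exact ⟨y, x, h, hy.1.1, hx.1.2, hy.2, hx.2⟩
  obtain ⟨x₁, x₂, h12, h1, h2, e1, e2⟩ := ordered _ _ hA
  obtain ⟨x₃, x₄, h34, h3, h4, e3, e4⟩ := ordered _ _ hB
  exact not_two_agreements huv hL hR hg h1 h12 h2 h3 h34 h4 e1 e2 e3 e4

/-- If all nodes of `κ` have the same half-width `w`, every convex function differs from `hardFn` in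
at least `w l - 1` points per node of `κ`. -/
theorem le_ncard_disagreement {M n l w : ℕ} {T : ℤ} (hT : 4 * ((M : ℤ) + 1) ^ 2 ≤ T) (hl : 0 < l)
    (κ : Finset ℕ) {p : (Fin (M + 1) → ℤ) × (Fin (M + 1) → ℤ)} (hp : p ∈ paramBox M T)
    (hκ : ∀ i ∈ κ, i ≠ 0 ∧ i + w ≤ M ∧ halfWidth i = w) (hin : M * l ≤ n)
    {g : Fin n → ℝ} (hg : IsConvexFn g) :
    κ.card * (w * l - 1) ≤ {x : Fin n | hardFn l κ p.1 p.2 x ≠ g x}.ncard := by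
  classical
  have hcard : {x : Fin n | hardFn l κ p.1 p.2 x ≠ g x}.ncard =
      (Finset.univ.filter fun x : Fin n => hardFn l κ p.1 p.2 x ≠ g x).card := by
    rw [← Set.ncard_coe_finset]; simp
  rw [hcard]
  let D : ℕ → Finset (Fin n) := fun i => Finset.univ.filter fun x : Fin n =>
    hardFn l κ p.1 p.2 x ≠ g x ∧ ((i - w) * l ≤ (x : ℕ) ∧ (x : ℕ) < (i + w) * l)
  have hdisj : (κ : Set ℕ).PairwiseDisjoint D := by
    intro i hi i' hi' hne
    rw [Function.onFun, Finset.disjoint_left]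
    intro x hx hx'
    simp only [D, Finset.mem_filter, Finset.mem_univ, true_and] at hx hx'
    obtain ⟨h0, h1, h2⟩ := hκ i hi
    obtain ⟨h0', h1', h2'⟩ := hκ i' hi'
    have hwi := halfWidth_le h0
    have hwi' := halfWidth_le h0'
    have b1 := lt_of_mul_lt_mul_right (hx.2.1.trans_lt hx'.2.2) (Nat.zero_le l)
    have b2 := lt_of_mul_lt_mul_right (hx'.2.1.trans_lt hx.2.2) (Nat.zero_le l)
    have d1 := two_mul_halfWidth_dvd_add h0
    have d2 := two_mul_halfWidth_dvd_add h0'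
    rw [h2] at d1 hwi
    rw [h2'] at d2 hwi'
    have := eq_of_dvd_of_near d1 d2 (by omega) (by omega)
    omega
  calc κ.card * (w * l - 1) = ∑ i ∈ κ, (w * l - 1) := by simp
    _ ≤ ∑ i ∈ κ, (D i).card := by
      refine Finset.sum_le_sum fun i hi => ?_
      obtain ⟨h0, h1, h2⟩ := hκ i hi
      have := le_card_disagreement_node hT hl κ hp ⟨i, by omega⟩ h0 hi
        (by simp only [h2]; exact (Nat.mul_le_mul_right l h1).trans hin) hg
      simpa only [h2] using this
    _ = (κ.biUnion D).card := (Finset.card_biUnion hdisj).symm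
    _ ≤ _ := by
      refine Finset.card_le_card fun x hx => ?_
      simp only [D, Finset.mem_biUnion, Finset.mem_filter, Finset.mem_univ, true_and] at hx ⊢
      obtain ⟨i, _, h, _⟩ := hx
      exact h

/-! ### Modifying the parameters away from the queries -/

/-- `HasLeft Q i`: some block of `Q` lies in the left half of node `i`. -/
def HasLeft (Q : Finset ℕ) (i : ℕ) : Prop := ∃ x ∈ Q, i - halfWidth i ≤ x ∧ x < i

/-- `HasRight Q i`: some block of `Q` lies in the right half of node `i`. -/
def HasRight (Q : Finset ℕ) (i : ℕ) : Prop := ∃ x ∈ Q, i ≤ x ∧ x < i + halfWidth i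

/-- The node `i` is caught by the queried blocks `Q` if they meet its left half and also its right
half or the right half of the node at its right end, or symmetrically. Only for a caught node
can the queries reveal whether its jump is positive. -/
def Caught (Q : Finset ℕ) (i : ℕ) : Prop :=
  (HasLeft Q i ∧ (HasRight Q i ∨ HasRight Q (i + halfWidth i))) ∨
    (HasRight Q i ∧ (HasLeft Q i ∨ HasLeft Q (i - halfWidth i)))

/-- A set of nodes of common half-width `w` whose two neighbours are nodes as well. -/
structure IsNodeClass (M w : ℕ) (κ : Finset ℕ) : Prop where
  halfWidth_eq : ∀ i ∈ κ, halfWidth i = w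
  left_ne : ∀ i ∈ κ, i - w ≠ 0
  right_le : ∀ i ∈ κ, i + w ≤ M

/-- The node at the left end of node `i`. -/
def leftNbr {M : ℕ} (i : Fin (M + 1)) : Fin (M + 1) := ⟨i - halfWidth i, by omega⟩

/-- The node at the right end of node `i`, truncated to the range of nodes. -/
def rightNbr {M : ℕ} (i : Fin (M + 1)) : Fin (M + 1) := ⟨min (i + halfWidth i) M, by omega⟩

/-- The nodes of `κ` as parameter indices. -/
def classIdx (M : ℕ) (κ : Finset ℕ) : Finset (Fin (M + 1)) :=
  Finset.univ.filter fun i => (i : ℕ) ∈ κ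

theorem mem_classIdx {M : ℕ} {κ : Finset ℕ} {i : Fin (M + 1)} :
    i ∈ classIdx M κ ↔ (i : ℕ) ∈ κ := by simp [classIdx]

open Classical in
/-- The change of `z` that, together with `nodeShiftD`, undoes the effect of reversing the jump of
node `i` at all points whose block is in `Q`, provided that `i` is not caught. -/
noncomputable def nodeShiftZ {M : ℕ} (Q : Finset ℕ) (d : Fin (M + 1) → ℤ) (i : Fin (M + 1)) :
    Fin (M + 1) → ℤ :=
  if HasLeft Q i then 0
  else if HasRight Q i then Pi.single i (2 * d i) - Pi.single (leftNbr i) (2 * d i)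
  else Pi.single i (d i)

open Classical in
/-- The change of `d` that goes with `nodeShiftZ`. -/
noncomputable def nodeShiftD {M : ℕ} (Q : Finset ℕ) (d : Fin (M + 1) → ℤ) (i : Fin (M + 1)) :
    Fin (M + 1) → ℤ :=
  if HasLeft Q i then Pi.single (rightNbr i) (2 * d i)
  else if HasRight Q i then Pi.single (leftNbr i) (2 * d i)
  else 0

/-- Parameters of a function with reversed jumps on `κ` that takes, on the blocks of `Q`, the same
values as the convex function with parameters `p`, provided that no node of `κ` is caught. -/
noncomputable def transfer {M : ℕ} (Q κ : Finset ℕ)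
    (p : (Fin (M + 1) → ℤ) × (Fin (M + 1) → ℤ)) : (Fin (M + 1) → ℤ) × (Fin (M + 1) → ℤ) :=
  (p.1 + ∑ i ∈ classIdx M κ, nodeShiftZ Q p.2 i, p.2 + ∑ i ∈ classIdx M κ, nodeShiftD Q p.2 i)

theorem hardFn_add {M l : ℕ} (κ : Finset ℕ) (z z' d d' : Fin (M + 1) → ℤ) (x : ℕ) :
    hardFn l κ (z + z') (d + d') x = hardFn l κ z d x + hardFn l κ z' d' x := by
  unfold hardFn
  rw [← Finset.sum_add_distrib]
  refine Finset.sum_congr rfl fun i _ => ?_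
  simp only [Pi.add_apply, Int.cast_add]
  ring

theorem hardFn_zero {M l : ℕ} (κ : Finset ℕ) (x : ℕ) :
    hardFn l κ (0 : Fin (M + 1) → ℤ) 0 x = 0 := by
  simp [hardFn]

theorem hardFn_sum {M l : ℕ} {ι : Type*} (κ : Finset ℕ) (s : Finset ι) (z d : ι → Fin (M + 1) → ℤ)
    (x : ℕ) : hardFn l κ (∑ i ∈ s, z i) (∑ i ∈ s, d i) x = ∑ i ∈ s, hardFn l κ (z i) (d i) x := by
  classical
  induction s using Finset.induction_on with
  | empty => simp [hardFn_zero]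
  | insert a s ha ih =>
    rw [Finset.sum_insert ha, Finset.sum_insert ha, Finset.sum_insert ha, hardFn_add, ih]

theorem hardFn_single_left {M l : ℕ} (κ : Finset ℕ) (i : Fin (M + 1)) (v : ℤ) (x : ℕ) :
    hardFn l κ (Pi.single i v) 0 x = v * (leftRamp l i x + rightRamp l i x) := by
  unfold hardFn
  rw [Finset.sum_eq_single i]
  · simp; ring
  · intro j _ hj
    simp [Pi.single_eq_of_ne hj]
  · simp

theorem hardFn_single_right {M l : ℕ} (κ : Finset ℕ) (i : Fin (M + 1)) (v : ℤ) (x : ℕ) :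
    hardFn l κ 0 (Pi.single i v) x = jumpSign κ i * v * rightRamp l i x := by
  unfold hardFn
  rw [Finset.sum_eq_single i]
  · simp
  · intro j _ hj
    simp [Pi.single_eq_of_ne hj]
  · simp

/-- Reversing the jumps of `κ` changes the function by multiples of right ramps. -/
theorem hardFn_empty_eq {M l : ℕ} (κ : Finset ℕ) (z d : Fin (M + 1) → ℤ) (x : ℕ) :
    hardFn l ∅ z d x =
      hardFn l κ z d x + ∑ i ∈ classIdx M κ, 2 * (d i : ℝ) * rightRamp l i x := by
  unfold hardFn classIdx
  rw [Finset.sum_filter, ← Finset.sum_add_distrib]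
  refine Finset.sum_congr rfl fun i _ => ?_
  unfold jumpSign
  by_cases h : (i : ℕ) ∈ κ
  · simp [h]; ring
  · simp [h]

theorem IsNodeClass.lt_halfWidth_leftNbr {M w : ℕ} {κ : Finset ℕ} (hκ : IsNodeClass M w κ)
    {i : Fin (M + 1)} (hi : (i : ℕ) ∈ κ) : w < halfWidth (leftNbr i) := by
  have h1 := hκ.halfWidth_eq i hi
  have h2 := hκ.left_ne i hi
  rw [← h1] at h2 ⊢
  exact halfWidth_lt_halfWidth_sub h2

theorem IsNodeClass.rightNbr_eq {M w : ℕ} {κ : Finset ℕ} (hκ : IsNodeClass M w κ)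
    {i : Fin (M + 1)} (hi : (i : ℕ) ∈ κ) : (rightNbr i : ℕ) = i + halfWidth i := by
  have h1 := hκ.halfWidth_eq i hi
  have h2 := hκ.right_le i hi
  simp only [rightNbr, h1]
  omega

theorem IsNodeClass.ne_zero {M w : ℕ} {κ : Finset ℕ} (hκ : IsNodeClass M w κ)
    {i : ℕ} (hi : i ∈ κ) : i ≠ 0 := by
  have := hκ.left_ne i hi
  omega

theorem IsNodeClass.lt_halfWidth_rightNbr {M w : ℕ} {κ : Finset ℕ} (hκ : IsNodeClass M w κ)
    {i : Fin (M + 1)} (hi : (i : ℕ) ∈ κ) : w < halfWidth (rightNbr i) := by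
  rw [hκ.rightNbr_eq hi, ← hκ.halfWidth_eq i hi]
  exact halfWidth_lt_halfWidth_add (hκ.ne_zero hi)

theorem IsNodeClass.notMem {M w : ℕ} {κ : Finset ℕ} (hκ : IsNodeClass M w κ) {j : ℕ}
    (hj : w < halfWidth j) : j ∉ κ := fun h => by
  have := hκ.halfWidth_eq j h
  omega

theorem rightRamp_eq_zero {l i x : ℕ} (h : x ≤ i * l) : rightRamp l i x = 0 := by
  unfold rightRamp
  split_ifs
  · rfl
  · exact ramp_eq_zero h

theorem rightRamp_eq_top {l i x : ℕ} (hi : i ≠ 0) (h : (i + halfWidth i) * l ≤ x) :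
    rightRamp l i x = l := by
  rw [rightRamp, if_neg hi]
  exact ramp_eq_top (halfWidth_pos i) h

theorem leftRamp_eq_zero {l i x : ℕ} (h : x ≤ (i - halfWidth i) * l) : leftRamp l i x = 0 := by
  unfold leftRamp
  split_ifs
  · rfl
  · exact ramp_eq_zero h

theorem leftRamp_eq_top {l i x : ℕ} (hi : i ≠ 0) (h : i * l ≤ x) : leftRamp l i x = l := by
  rw [leftRamp, if_neg hi]
  exact ramp_eq_top (halfWidth_pos i) (by rwa [Nat.sub_add_cancel (halfWidth_le hi)])

/-- At a queried point, the modification belonging to an uncaught node cancels the effect of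
reversing its jump. -/
theorem hardFn_nodeShift {M w l : ℕ} (hl : 0 < l) {κ : Finset ℕ} (hκ : IsNodeClass M w κ)
    (Q : Finset ℕ) (d : Fin (M + 1) → ℤ) {i : Fin (M + 1)} (hi : (i : ℕ) ∈ κ) (hc : ¬ Caught Q i)
    {x : ℕ} (hx : x / l ∈ Q) :
    hardFn l κ (nodeShiftZ Q d i) (nodeShiftD Q d i) x = 2 * (d i : ℝ) * rightRamp l i x := by
  have hi0 := hκ.ne_zero hi
  have hle := halfWidth_le hi0
  -- Outside a range of blocks `[u, v)` that contains no query, a queried point lies to one side.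
  have side : ∀ u v : ℕ, ¬ (u ≤ x / l ∧ x / l < v) → x ≤ u * l ∨ v * l ≤ x := by
    intro u v h
    rcases lt_or_ge (x / l) u with h' | h'
    · exact Or.inl ((Nat.div_lt_iff_lt_mul hl).1 h').le
    · exact Or.inr ((Nat.le_div_iff_mul_le hl).1 (by omega))
  have mono : ∀ {u v y : ℕ}, u ≤ v → y ≤ u * l → y ≤ v * l :=
    fun h h' => h'.trans (Nat.mul_le_mul_right l h)
  have mono' : ∀ {u v y : ℕ}, u ≤ v → v * l ≤ y → u * l ≤ y :=
    fun h h' => (Nat.mul_le_mul_right l h).trans h'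
  unfold Caught at hc
  push Not at hc
  obtain ⟨hcL, hcR⟩ := hc
  unfold nodeShiftZ nodeShiftD
  by_cases hL : HasLeft Q i
  · rw [if_pos hL, if_pos hL, hardFn_single_right, jumpSign,
      if_neg (hκ.notMem (hκ.lt_halfWidth_rightNbr hi))]
    have hr := hκ.rightNbr_eq hi
    have hr0 : (rightNbr i : ℕ) ≠ 0 := by omega
    obtain ⟨n1, n2⟩ := hcL hL
    rw [← hr] at n2
    have : ¬ ((i : ℕ) ≤ x / l ∧ x / l < rightNbr i + halfWidth (rightNbr i)) := by
      rintro ⟨h1, h2⟩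
      rcases lt_or_ge (x / l) (rightNbr i) with h | h
      · exact n1 ⟨_, hx, h1, by omega⟩
      · exact n2 ⟨_, hx, h, h2⟩
    have hramp : rightRamp l (rightNbr i) x = rightRamp l i x := by
      rcases side _ _ this with h | h
      · rw [rightRamp_eq_zero h, rightRamp_eq_zero (mono (by omega) h)]
      · rw [rightRamp_eq_top hr0 h, rightRamp_eq_top hi0 (mono' (by omega) h)]
    rw [hramp]
    push_cast
    ring
  rw [if_neg hL, if_neg hL]
  by_cases hR : HasRight Q i
  · rw [if_pos hR, if_pos hR]
    have hsplit : hardFn l κ (Pi.single i (2 * d i) - Pi.single (leftNbr i) (2 * d i))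
        (Pi.single (leftNbr i) (2 * d i)) x =
        hardFn l κ (Pi.single i (2 * d i)) 0 x + hardFn l κ (Pi.single (leftNbr i) (-(2 * d i))) 0 x
          + hardFn l κ 0 (Pi.single (leftNbr i) (2 * d i)) x := by
      rw [← hardFn_add, ← hardFn_add, Pi.single_neg]
      simp [sub_eq_add_neg]
    rw [hsplit, hardFn_single_left, hardFn_single_left, hardFn_single_right, jumpSign,
      if_neg (hκ.notMem (hκ.lt_halfWidth_leftNbr hi))]
    have hr : (leftNbr i : ℕ) = i - halfWidth i := rfl
    have hr0 : (leftNbr i : ℕ) ≠ 0 := by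
      rw [hr, hκ.halfWidth_eq _ hi]; exact hκ.left_ne _ hi
    obtain ⟨n1, n2⟩ := hcR hR
    rw [← hr] at n2
    have : ¬ (leftNbr i - halfWidth (leftNbr i) ≤ x / l ∧ x / l < (i : ℕ)) := by
      rintro ⟨h1, h2⟩
      rcases lt_or_ge (x / l) (leftNbr i) with h | h
      · exact n2 ⟨_, hx, h1, h⟩
      · exact n1 ⟨_, hx, by omega, h2⟩
    have hramp : leftRamp l (leftNbr i) x = leftRamp l i x := by
      rcases side _ _ this with h | h
      · rw [leftRamp_eq_zero h, leftRamp_eq_zero (mono (by omega) h)]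
      · rw [leftRamp_eq_top hr0 (mono' (by omega) h), leftRamp_eq_top hi0 h]
    rw [hramp]
    push_cast
    ring
  · rw [if_neg hR, if_neg hR, hardFn_single_left]
    have : ¬ (i - halfWidth i ≤ x / l ∧ x / l < i + halfWidth i) := by
      rintro ⟨h1, h2⟩
      rcases lt_or_ge (x / l) i with h | h
      · exact hL ⟨_, hx, h1, h⟩
      · exact hR ⟨_, hx, h, h2⟩
    have hramp : leftRamp l i x = rightRamp l i x := by
      rcases side _ _ this with h | h
      · rw [leftRamp_eq_zero h, rightRamp_eq_zero (mono (by omega) h)]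
      · rw [leftRamp_eq_top hi0 (mono' (by omega) h), rightRamp_eq_top hi0 h]
    rw [hramp]
    ring

theorem hardFn_transfer {M w l : ℕ} (hl : 0 < l) {κ : Finset ℕ} (hκ : IsNodeClass M w κ)
    (Q : Finset ℕ) (p : (Fin (M + 1) → ℤ) × (Fin (M + 1) → ℤ)) (hc : ∀ i ∈ κ, ¬ Caught Q i)
    {x : ℕ} (hx : x / l ∈ Q) :
    hardFn l κ (transfer Q κ p).1 (transfer Q κ p).2 x = hardFn l ∅ p.1 p.2 x := by
  rw [transfer, hardFn_add, hardFn_sum, hardFn_empty_eq κ]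
  congr 1
  refine Finset.sum_congr rfl fun i hi => ?_
  rw [mem_classIdx] at hi
  exact hardFn_nodeShift hl hκ Q p.2 hi (hc i hi) hx

theorem nodeShiftD_apply_eq_zero {M w : ℕ} {κ : Finset ℕ} (hκ : IsNodeClass M w κ) (Q : Finset ℕ)
    (d : Fin (M + 1) → ℤ) {i j : Fin (M + 1)} (hi : (i : ℕ) ∈ κ) (hj : halfWidth j ≤ w) :
    nodeShiftD Q d i j = 0 := by
  have h1 : j ≠ leftNbr i := by
    rintro rfl; exact absurd (hκ.lt_halfWidth_leftNbr hi) (by omega)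
  have h2 : j ≠ rightNbr i := by
    rintro rfl; exact absurd (hκ.lt_halfWidth_rightNbr hi) (by omega)
  unfold nodeShiftD
  split_ifs
  · exact Pi.single_eq_of_ne h2 _
  · exact Pi.single_eq_of_ne h1 _
  · rfl

theorem nodeShiftZ_apply_eq_zero {M w : ℕ} {κ : Finset ℕ} (hκ : IsNodeClass M w κ) (Q : Finset ℕ)
    (d : Fin (M + 1) → ℤ) {i j : Fin (M + 1)} (hi : (i : ℕ) ∈ κ) (hj : halfWidth j < w) :
    nodeShiftZ Q d i j = 0 := by
  have h1 : j ≠ leftNbr i := by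
    rintro rfl; exact absurd (hκ.lt_halfWidth_leftNbr hi) (by omega)
  have h2 : j ≠ i := by
    rintro rfl; exact absurd (hκ.halfWidth_eq _ hi) (by omega)
  unfold nodeShiftZ
  split_ifs
  · rfl
  · simp [Pi.single_eq_of_ne h1, Pi.single_eq_of_ne h2]
  · exact Pi.single_eq_of_ne h2 _

theorem transfer_injective {M w : ℕ} {κ : Finset ℕ} (hκ : IsNodeClass M w κ) (Q : Finset ℕ) :
    Function.Injective (transfer (M := M) Q κ) := by
  -- The jumps of `κ` are kept, and the shift is determined by them.
  have keep : ∀ p : (Fin (M + 1) → ℤ) × (Fin (M + 1) → ℤ), ∀ i ∈ classIdx M κ,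
      (transfer Q κ p).2 i = p.2 i := by
    intro p i hi
    rw [mem_classIdx] at hi
    simp only [transfer, Pi.add_apply, Finset.sum_apply]
    rw [Finset.sum_eq_zero, add_zero]
    intro j hj
    exact nodeShiftD_apply_eq_zero hκ Q _ (mem_classIdx.1 hj) (hκ.halfWidth_eq _ hi).le
  intro p p' h
  have hd : ∀ i ∈ classIdx M κ, p.2 i = p'.2 i := fun i hi => by
    rw [← keep p i hi, ← keep p' i hi, h]
  have h1 : ∑ i ∈ classIdx M κ, nodeShiftZ Q p.2 i = ∑ i ∈ classIdx M κ, nodeShiftZ Q p'.2 i :=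
    Finset.sum_congr rfl fun i hi => by rw [nodeShiftZ, nodeShiftZ, hd i hi]
  have h2 : ∑ i ∈ classIdx M κ, nodeShiftD Q p.2 i = ∑ i ∈ classIdx M κ, nodeShiftD Q p'.2 i :=
    Finset.sum_congr rfl fun i hi => by rw [nodeShiftD, nodeShiftD, hd i hi]
  rw [transfer, transfer, Prod.mk.injEq, h1, h2] at h
  exact Prod.ext (add_right_cancel h.1) (add_right_cancel h.2)

theorem abs_single_apply_le {M : ℕ} (a j : Fin (M + 1)) {v b : ℤ} (hv : 0 ≤ v) (hb : v ≤ b) :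
    |(Pi.single a v : Fin (M + 1) → ℤ) j| ≤ b := by
  rw [Pi.single_apply]
  split_ifs
  · rwa [abs_of_nonneg hv]
  · simpa using hv.trans hb

theorem single_apply_nonneg {M : ℕ} (a j : Fin (M + 1)) {v : ℤ} (hv : 0 ≤ v) :
    0 ≤ (Pi.single a v : Fin (M + 1) → ℤ) j := by
  rw [Pi.single_apply]
  split_ifs
  · exact hv
  · exact le_rfl

/-- The parameters that every `transfer` keeps inside `paramBox`. -/
noncomputable def innerBox (M : ℕ) (T : ℤ) : Finset ((Fin (M + 1) → ℤ) × (Fin (M + 1) → ℤ)) :=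
  (Fintype.piFinset fun i : Fin (M + 1) =>
      Finset.Ico (8 * (M + 1) * T ^ (2 * padicValNat 2 i + 1))
        (T ^ (2 * padicValNat 2 i + 2) - 8 * (M + 1) * T ^ (2 * padicValNat 2 i + 1))) ×ˢ
    (Fintype.piFinset fun i : Fin (M + 1) =>
      Finset.Ico (T ^ (2 * padicValNat 2 i + 1))
        (2 * T ^ (2 * padicValNat 2 i + 1) - 8 * (M + 1) * T ^ (2 * padicValNat 2 i)))

theorem mem_innerBox {M : ℕ} {T : ℤ} {p : (Fin (M + 1) → ℤ) × (Fin (M + 1) → ℤ)} :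
    p ∈ innerBox M T ↔
      (∀ i : Fin (M + 1), 8 * (M + 1) * T ^ (2 * padicValNat 2 i + 1) ≤ p.1 i ∧
        p.1 i < T ^ (2 * padicValNat 2 i + 2) - 8 * (M + 1) * T ^ (2 * padicValNat 2 i + 1)) ∧
      (∀ i : Fin (M + 1), T ^ (2 * padicValNat 2 i + 1) ≤ p.2 i ∧
        p.2 i < 2 * T ^ (2 * padicValNat 2 i + 1) - 8 * (M + 1) * T ^ (2 * padicValNat 2 i)) := by
  simp [innerBox, Fintype.mem_piFinset]

theorem innerBox_subset {M : ℕ} {T : ℤ} (hT : 1 ≤ T) : innerBox M T ⊆ paramBox M T := by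
  intro p hp
  obtain ⟨hz, hd⟩ := mem_innerBox.1 hp
  have hT0 : (0 : ℤ) ≤ T := by omega
  refine mem_paramBox.2 ⟨fun i => ?_, fun i => ?_⟩
  · have h0 : 0 ≤ 8 * ((M : ℤ) + 1) * T ^ (2 * padicValNat 2 i + 1) := by positivity
    have := hz i
    constructor <;> linarith
  · have h0 : 0 ≤ 8 * ((M : ℤ) + 1) * T ^ (2 * padicValNat 2 i) := by positivity
    have := hd i
    constructor <;> linarith

theorem transfer_mem_paramBox {M w : ℕ} {T : ℤ} (hT : 1 ≤ T) {κ : Finset ℕ}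
    (hκ : IsNodeClass M w κ) (Q : Finset ℕ) {p : (Fin (M + 1) → ℤ) × (Fin (M + 1) → ℤ)}
    (hp : p ∈ innerBox M T) : transfer Q κ p ∈ paramBox M T := by
  have hp' := innerBox_subset hT hp
  obtain ⟨hz, hd⟩ := mem_innerBox.1 hp
  obtain ⟨_, hd'⟩ := mem_paramBox.1 hp'
  have hT0 : (0 : ℤ) ≤ T := by omega
  have hd0 : ∀ i, 0 ≤ p.2 i := fun i => (pow_nonneg hT0 _).trans (hd i).1
  have hcard : ((classIdx M κ).card : ℤ) ≤ M + 1 := by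
    have := Finset.card_le_univ (classIdx M κ)
    rw [Fintype.card_fin] at this
    exact_mod_cast this
  have sum_le : ∀ (F : Fin (M + 1) → ℤ) (b : ℤ), 0 ≤ b → (∀ i ∈ classIdx M κ, |F i| ≤ b) →
      |∑ i ∈ classIdx M κ, F i| ≤ (M + 1) * b := by
    intro F b hb h
    refine (Finset.abs_sum_le_sum_abs _ _).trans ((Finset.sum_le_card_nsmul _ _ _ h).trans ?_)
    rw [nsmul_eq_mul]
    exact mul_le_mul_of_nonneg_right hcard hb
  have level : ∀ {i j : ℕ}, halfWidth i ≤ halfWidth j → padicValNat 2 i ≤ padicValNat 2 j := by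
    intro i j h
    by_contra hc
    exact absurd (padicValNat_lt_iff.1 (not_le.1 hc)) (by omega)
  refine mem_paramBox.2 ⟨fun j => ?_, fun j => ?_⟩
  · have hb : |∑ i ∈ classIdx M κ, nodeShiftZ Q p.2 i j| ≤
        (M + 1) * (8 * T ^ (2 * padicValNat 2 j + 1)) := by
      refine sum_le _ _ (by positivity) fun i hi => ?_
      rw [mem_classIdx] at hi
      rcases lt_or_ge (halfWidth j) w with hj | hj
      · rw [nodeShiftZ_apply_eq_zero hκ Q _ hi hj, abs_zero]; positivity
      have hdi : p.2 i ≤ 2 * T ^ (2 * padicValNat 2 j + 1) := by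
        refine (hd' i).2.le.trans (mul_le_mul_of_nonneg_left (pow_le_pow_right₀ hT ?_) (by norm_num))
        have := level (i := i) (j := j) (by rw [hκ.halfWidth_eq _ hi]; exact hj)
        omega
      have h0 := hd0 i
      unfold nodeShiftZ
      split_ifs
      · rw [Pi.zero_apply, abs_zero]; positivity
      · rw [Pi.sub_apply]
        have a1 := abs_single_apply_le i j (v := 2 * p.2 i) (by omega) le_rfl
        have a2 := abs_single_apply_le (leftNbr i) j (v := 2 * p.2 i) (by omega) le_rfl
        exact (abs_sub _ _).trans (by linarith)
      · exact abs_single_apply_le i j h0 (by linarith)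
    have := hz j
    have hb' := abs_le.1 hb
    simp only [transfer, Pi.add_apply, Finset.sum_apply]
    constructor <;> linarith
  · have hb : |∑ i ∈ classIdx M κ, nodeShiftD Q p.2 i j| ≤
        (M + 1) * (8 * T ^ (2 * padicValNat 2 j)) := by
      refine sum_le _ _ (by positivity) fun i hi => ?_
      rw [mem_classIdx] at hi
      rcases le_or_gt (halfWidth j) w with hj | hj
      · rw [nodeShiftD_apply_eq_zero hκ Q _ hi hj, abs_zero]; positivity
      have hdi : p.2 i ≤ 2 * T ^ (2 * padicValNat 2 j) := by
        refine (hd' i).2.le.trans (mul_le_mul_of_nonneg_left (pow_le_pow_right₀ hT ?_) (by norm_num))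
        have := padicValNat_lt_iff.2 ((hκ.halfWidth_eq _ hi).trans_lt hj)
        omega
      have h0 := hd0 i
      unfold nodeShiftD
      split_ifs
      · exact abs_single_apply_le _ j (by omega) (by linarith)
      · exact abs_single_apply_le _ j (by omega) (by linarith)
      · rw [Pi.zero_apply, abs_zero]; positivity
    have hnn : 0 ≤ ∑ i ∈ classIdx M κ, nodeShiftD Q p.2 i j := by
      refine Finset.sum_nonneg fun i _ => ?_
      have h0 := hd0 i
      unfold nodeShiftD
      split_ifs
      · exact single_apply_nonneg _ j (by omega)
      · exact single_apply_nonneg _ j (by omega)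
      · exact le_rfl
    have := hd j
    have hb' := abs_le.1 hb
    simp only [transfer, Pi.add_apply, Finset.sum_apply]
    constructor <;> linarith

/-- The input `[n] → ℝ` given by `hardFn` with blocks of `l` points. -/
noncomputable def hardInput (n : ℕ) {M : ℕ} (l : ℕ) (κ : Finset ℕ)
    (p : (Fin (M + 1) → ℤ) × (Fin (M + 1) → ℤ)) : Fin n → ℝ :=
  fun x => hardFn l κ p.1 p.2 x

/-- The blocks in which a deterministic algorithm queries the convex input with parameters `p`. -/
noncomputable def queriedBlocks {n M : ℕ} (l : ℕ) (A : QueryAlgorithm n)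
    (p : (Fin (M + 1) → ℤ) × (Fin (M + 1) → ℤ)) : Finset ℕ :=
  (A.querySet (hardInput n l ∅ p)).image fun x : Fin n => (x : ℕ) / l

open Classical in
/-- A deterministic algorithm accepts at least as many inputs with reversed jumps on `κ` as convex
inputs, up to those for which a node of `κ` is caught and those on the boundary of the parameter
box. -/
theorem card_accept_le {n M w l : ℕ} {T : ℤ} (hT : 1 ≤ T) (hl : 0 < l) {κ : Finset ℕ}
    (hκ : IsNodeClass M w κ) (A : QueryAlgorithm n) :
    ((paramBox M T).filter fun p => A.run (hardInput n l ∅ p) = true).card ≤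
      ((paramBox M T).filter fun p => A.run (hardInput n l κ p) = true).card +
      ((paramBox M T).filter fun p => ∃ i ∈ κ, Caught (queriedBlocks l A p) i).card +
      (paramBox M T \ innerBox M T).card := by
  set S := (innerBox M T).filter fun p => A.run (hardInput n l ∅ p) = true ∧
    ¬ ∃ i ∈ κ, Caught (queriedBlocks l A p) i with hS
  have path : ∀ p ∈ S,
      A.run (hardInput n l κ (transfer (queriedBlocks l A p) κ p)) = true ∧
      A.querySet (hardInput n l κ (transfer (queriedBlocks l A p) κ p)) =
        A.querySet (hardInput n l ∅ p) := by
    intro p hp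
    obtain ⟨-, h1, h2⟩ := Finset.mem_filter.1 hp
    push Not at h2
    have := A.run_eq_of_eqOn (f := hardInput n l ∅ p)
      (g := hardInput n l κ (transfer (queriedBlocks l A p) κ p)) fun x hx =>
        hardFn_transfer hl hκ _ p h2 (Finset.mem_image_of_mem (fun x : Fin n => (x : ℕ) / l) hx)
    exact ⟨this.1.trans h1, this.2⟩
  have hcard : S.card ≤ ((paramBox M T).filter fun p => A.run (hardInput n l κ p) = true).card := by
    refine Finset.card_le_card_of_injOn (fun p => transfer (queriedBlocks l A p) κ p) ?_ ?_
    · intro p hp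
      exact Finset.mem_filter.2
        ⟨transfer_mem_paramBox hT hκ _ (Finset.mem_filter.1 hp).1, (path p hp).1⟩
    · intro p hp p' hp' h
      have h : transfer (queriedBlocks l A p) κ p = transfer (queriedBlocks l A p') κ p' := h
      -- The algorithm follows the same path on all three inputs, so the query sets agree.
      have hQ : queriedBlocks l A p = queriedBlocks l A p' := by
        unfold queriedBlocks
        rw [← (path p hp).2, ← (path p' hp').2, h]
      rw [hQ] at h
      exact transfer_injective hκ _ h
  have hsub : ((paramBox M T).filter fun p => A.run (hardInput n l ∅ p) = true) ⊆
      (S ∪ (paramBox M T).filter fun p => ∃ i ∈ κ, Caught (queriedBlocks l A p) i) ∪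
        (paramBox M T \ innerBox M T) := by
    intro p hp
    rw [Finset.mem_filter] at hp
    rw [Finset.mem_union, Finset.mem_union, Finset.mem_sdiff, hS, Finset.mem_filter,
      Finset.mem_filter]
    tauto
  refine (Finset.card_le_card hsub).trans ((Finset.card_union_le _ _).trans ?_)
  exact Nat.add_le_add_right ((Finset.card_union_le _ _).trans (Nat.add_le_add_right hcard _)) _

/-! ### Counting caught nodes -/

/-- The blocks `x < y` lie in the left and in the right half of node `i`. -/
def Separates (i x y : ℕ) : Prop :=
  i ≠ 0 ∧ i - halfWidth i ≤ x ∧ x < i ∧ i ≤ y ∧ y < i + halfWidth i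

/-- Two blocks are separated by at most one node, their lowest common ancestor. -/
theorem Separates.unique {i i' x y : ℕ} (h : Separates i x y) (h' : Separates i' x y) :
    i = i' := by
  wlog hw : halfWidth i ≤ halfWidth i' generalizing i i'
  · exact (this h' h (by omega)).symm
  have hd := (halfWidth_dvd_of_le hw).trans (halfWidth_dvd i')
  unfold Separates at h h'
  exact (eq_of_dvd_of_near (halfWidth_dvd i) hd (by omega) (by omega)).symm

theorem two_mul_halfWidth_le_of_lt {i j : ℕ} (h : halfWidth i < halfWidth j) :
    2 * halfWidth i ≤ halfWidth j :=
  Nat.le_of_dvd (halfWidth_pos j) (two_mul_halfWidth_dvd_of_lt h)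

/-- Two nodes with the same right end, whose left halves share a block, coincide. -/
theorem eq_of_add_halfWidth_eq {i i' x : ℕ} (h : i + halfWidth i = i' + halfWidth i')
    (h1 : i - halfWidth i ≤ x) (h2 : x < i) (h1' : i' - halfWidth i' ≤ x) (h2' : x < i') :
    i = i' := by
  rcases lt_trichotomy (halfWidth i) (halfWidth i') with hw | hw | hw
  · have := two_mul_halfWidth_le_of_lt hw; omega
  · omega
  · have := two_mul_halfWidth_le_of_lt hw; omega

/-- Two nodes with the same left end, whose right halves share a block, coincide. -/
theorem eq_of_sub_halfWidth_eq {i i' y : ℕ} (h0 : i - halfWidth i ≠ 0)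
    (h : i - halfWidth i = i' - halfWidth i')
    (h1 : i ≤ y) (h2 : y < i + halfWidth i) (h1' : i' ≤ y) (h2' : y < i' + halfWidth i') :
    i = i' := by
  rcases lt_trichotomy (halfWidth i) (halfWidth i') with hw | hw | hw
  · have := two_mul_halfWidth_le_of_lt hw; omega
  · omega
  · have := two_mul_halfWidth_le_of_lt hw; omega

theorem separates_right_end {i x y : ℕ} (hi : i ≠ 0) (h1 : i - halfWidth i ≤ x) (h2 : x < i)
    (h3 : i + halfWidth i ≤ y) (h4 : y < i + halfWidth i + halfWidth (i + halfWidth i)) :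
    Separates (i + halfWidth i) x y := by
  have := two_mul_halfWidth_le_of_lt (halfWidth_lt_halfWidth_add hi)
  unfold Separates
  omega

theorem separates_left_end {i x y : ℕ}
    (h1 : i - halfWidth i - halfWidth (i - halfWidth i) ≤ x) (h2 : x < i - halfWidth i)
    (h3 : i ≤ y) (h4 : y < i + halfWidth i) : Separates (i - halfWidth i) x y := by
  have := two_mul_halfWidth_le_of_lt (halfWidth_lt_halfWidth_sub (i := i) (by omega))
  unfold Separates
  omega

theorem exists_consecutive {Q : Finset ℕ} {i : ℕ} (hx : ∃ x ∈ Q, x < i) (hy : ∃ y ∈ Q, i ≤ y) :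
    ∃ x ∈ Q, ∃ y ∈ Q, (x < i ∧ i ≤ y) ∧ ∀ q ∈ Q, q ≤ x ∨ y ≤ q := by
  obtain ⟨x₀, hx₀, hx₀'⟩ := hx
  obtain ⟨y₀, hy₀, hy₀'⟩ := hy
  obtain ⟨x, hxm, hx⟩ := Finset.exists_max_image (Q.filter (· < i)) id
    ⟨x₀, Finset.mem_filter.2 ⟨hx₀, hx₀'⟩⟩
  obtain ⟨y, hym, hy⟩ := Finset.exists_min_image (Q.filter (i ≤ ·)) id
    ⟨y₀, Finset.mem_filter.2 ⟨hy₀, hy₀'⟩⟩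
  rw [Finset.mem_filter] at hxm hym
  refine ⟨x, hxm.1, y, hym.1, ⟨hxm.2, hym.2⟩, fun q hq => ?_⟩
  rcases lt_or_ge q i with h | h
  · exact Or.inl (hx q (Finset.mem_filter.2 ⟨hq, h⟩))
  · exact Or.inr (hy q (Finset.mem_filter.2 ⟨hq, h⟩))

/-- If every element of `S` is determined by a pair of consecutive elements of `Q`, then `S` is no
larger than `Q`. -/
theorem card_le_of_consecutive {Q S : Finset ℕ} (P : ℕ → ℕ → ℕ → Prop)
    (hex : ∀ i ∈ S, ∃ x ∈ Q, ∃ y ∈ Q, x < y ∧ (∀ q ∈ Q, q ≤ x ∨ y ≤ q) ∧ P i x y)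
    (huniq : ∀ i i' x y, P i x y → P i' x y → i = i') : S.card ≤ Q.card := by
  choose! x hx y hy hxy hgap hP using hex
  refine Finset.card_le_card_of_injOn x (fun i hi => hx i hi) ?_
  intro i hi i' hi' h
  have h1 := hgap i hi _ (hy i' hi')
  have h2 := hgap i' hi' _ (hy i hi)
  have h3 := hxy i hi
  have h4 := hxy i' hi'
  have hyy : y i = y i' := by omega
  refine huniq i i' (x i) (y i) (hP i hi) ?_
  rw [h, hyy]
  exact hP i' hi'

open Classical in
/-- A set of `q` queries catches at most `3 q` nodes: a caught node is determined by consecutive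
queries `x < y` around it and by whether `x` and `y` lie in its two halves, or one of them lies
beyond its right or left end. -/
theorem card_caught_le (Q N : Finset ℕ) (hN : ∀ i ∈ N, i ≠ 0) :
    (N.filter (Caught Q)).card ≤ 3 * Q.card := by
  have both : (N.filter fun i => HasLeft Q i ∧ HasRight Q i).card ≤ Q.card := by
    refine card_le_of_consecutive Separates (fun i hi => ?_) fun i i' x y => Separates.unique
    obtain ⟨hiN, ⟨x₀, hx₀, hx₀'⟩, y₀, hy₀, hy₀'⟩ := Finset.mem_filter.1 hi
    obtain ⟨x, hx, y, hy, hxy, hgap⟩ := exists_consecutive (Q := Q) (i := i)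
      ⟨x₀, hx₀, hx₀'.2⟩ ⟨y₀, hy₀, hy₀'.1⟩
    have h1 := hgap x₀ hx₀
    have h2 := hgap y₀ hy₀
    have := hN i hiN
    exact ⟨x, hx, y, hy, by omega, hgap, by unfold Separates; omega⟩
  have right : (N.filter fun i =>
      HasLeft Q i ∧ HasRight Q (i + halfWidth i) ∧ ¬ HasRight Q i).card ≤ Q.card := by
    refine card_le_of_consecutive (fun i x y => Separates (i + halfWidth i) x y ∧
      i - halfWidth i ≤ x ∧ x < i) (fun i hi => ?_) fun i i' x y h h' =>
      eq_of_add_halfWidth_eq (h.1.unique h'.1) h.2.1 h.2.2 h'.2.1 h'.2.2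
    obtain ⟨hiN, ⟨x₀, hx₀, hx₀'⟩, ⟨y₀, hy₀, hy₀'⟩, hno⟩ := Finset.mem_filter.1 hi
    obtain ⟨x, hx, y, hy, hxy, hgap⟩ := exists_consecutive (Q := Q) (i := i)
      ⟨x₀, hx₀, hx₀'.2⟩ ⟨y₀, hy₀, by omega⟩
    have h1 := hgap x₀ hx₀
    have h2 := hgap y₀ hy₀
    have h3 : i + halfWidth i ≤ y := by
      by_contra hc
      exact hno ⟨y, hy, hxy.2, by omega⟩
    exact ⟨x, hx, y, hy, by omega, hgap,
      separates_right_end (hN i hiN) (by omega) hxy.1 h3 (by omega), by omega, hxy.1⟩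
  have left : (N.filter fun i =>
      HasRight Q i ∧ HasLeft Q (i - halfWidth i) ∧ ¬ HasLeft Q i).card ≤ Q.card := by
    refine card_le_of_consecutive (fun i x y => Separates (i - halfWidth i) x y ∧
      i ≤ y ∧ y < i + halfWidth i) (fun i hi => ?_) fun i i' x y h h' =>
      eq_of_sub_halfWidth_eq h.1.1 (h.1.unique h'.1) h.2.1 h.2.2 h'.2.1 h'.2.2
    obtain ⟨hiN, ⟨y₀, hy₀, hy₀'⟩, ⟨x₀, hx₀, hx₀'⟩, hno⟩ := Finset.mem_filter.1 hi
    obtain ⟨x, hx, y, hy, hxy, hgap⟩ := exists_consecutive (Q := Q) (i := i)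
      ⟨x₀, hx₀, by omega⟩ ⟨y₀, hy₀, hy₀'.1⟩
    have h1 := hgap x₀ hx₀
    have h2 := hgap y₀ hy₀
    have h3 : x < i - halfWidth i := by
      by_contra hc
      exact hno ⟨x, hx, by omega, hxy.1⟩
    exact ⟨x, hx, y, hy, by omega, hgap,
      separates_left_end (by omega) h3 hxy.2 (by omega), hxy.2, by omega⟩
  have hsub : N.filter (Caught Q) ⊆ ((N.filter fun i => HasLeft Q i ∧ HasRight Q i) ∪
      (N.filter fun i => HasLeft Q i ∧ HasRight Q (i + halfWidth i) ∧ ¬ HasRight Q i)) ∪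
      (N.filter fun i => HasRight Q i ∧ HasLeft Q (i - halfWidth i) ∧ ¬ HasLeft Q i) := by
    intro i
    simp only [Finset.mem_union, Finset.mem_filter, Caught]
    tauto
  have c1 := Finset.card_le_card hsub
  have c2 := Finset.card_union_le ((N.filter fun i => HasLeft Q i ∧ HasRight Q i) ∪
      (N.filter fun i => HasLeft Q i ∧ HasRight Q (i + halfWidth i) ∧ ¬ HasRight Q i))
      (N.filter fun i => HasRight Q i ∧ HasLeft Q (i - halfWidth i) ∧ ¬ HasLeft Q i)
  have c3 := Finset.card_union_le (N.filter fun i => HasLeft Q i ∧ HasRight Q i)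
      (N.filter fun i => HasLeft Q i ∧ HasRight Q (i + halfWidth i) ∧ ¬ HasRight Q i)
  omega

open Classical in
/-- At most `3 |Q|` classes of a pairwise disjoint family contain a caught node. -/
theorem card_caught_classes_le {ι : Type*} (K : Finset ι) (κ : ι → Finset ℕ)
    (hdisj : (K : Set ι).PairwiseDisjoint κ) (h0 : ∀ t ∈ K, ∀ i ∈ κ t, i ≠ 0) (Q : Finset ℕ) :
    (K.filter fun t => ∃ i ∈ κ t, Caught Q i).card ≤ 3 * Q.card := by
  refine le_trans ?_ (card_caught_le Q (K.biUnion κ) fun i hi => by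
    obtain ⟨t, ht, hi⟩ := Finset.mem_biUnion.1 hi
    exact h0 t ht i hi)
  have hex : ∀ t ∈ K.filter fun t => ∃ i ∈ κ t, Caught Q i, ∃ i, i ∈ κ t ∧ Caught Q i :=
    fun t ht => (Finset.mem_filter.1 ht).2
  choose! f hf hc using hex
  refine Finset.card_le_card_of_injOn f (fun t ht => ?_) fun t ht t' ht' h => ?_
  · exact Finset.mem_filter.2 ⟨Finset.mem_biUnion.2 ⟨t, (Finset.mem_filter.1 ht).1, hf t ht⟩, hc t ht⟩
  · by_contra hne
    refine Finset.disjoint_left.1 (hdisj (Finset.mem_filter.1 ht).1 (Finset.mem_filter.1 ht').1 hne)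
      (hf t ht) ?_
    rw [h]
    exact hf t' ht'

/-! ### The node classes -/

theorem halfWidth_two_pow_mul_odd (k m : ℕ) : halfWidth (2 ^ k * (2 * m + 1)) = 2 ^ k := by
  have : Fact (Nat.Prime 2) := ⟨Nat.prime_two⟩
  unfold halfWidth
  rw [padicValNat.mul (by positivity) (by omega), padicValNat.prime_pow,
    padicValNat.eq_zero_of_not_dvd (by omega : ¬ 2 ∣ 2 * m + 1), add_zero]

/-- The nodes of level `k` strictly inside the `b`-th chunk of `2 ^ L` blocks. -/
def nodeClass (L b k : ℕ) : Finset ℕ :=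
  (Finset.range (2 ^ (L - 1 - k))).image fun t => b * 2 ^ L + 2 ^ k * (2 * t + 1)

theorem card_nodeClass (L b k : ℕ) : (nodeClass L b k).card = 2 ^ (L - 1 - k) := by
  rw [nodeClass, Finset.card_image_of_injective, Finset.card_range]
  intro t t' h
  have h' : 2 ^ k * (2 * t + 1) = 2 ^ k * (2 * t' + 1) := Nat.add_left_cancel h
  have := Nat.eq_of_mul_eq_mul_left (by positivity) h'
  omega

theorem two_pow_split {L k : ℕ} (hk : k < L) : 2 ^ L = 2 ^ k * (2 * 2 ^ (L - 1 - k)) := by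
  rw [← pow_succ', ← pow_add]
  congr 1
  omega

theorem halfWidth_of_mem_nodeClass {L b k i : ℕ} (hk : k < L) (hi : i ∈ nodeClass L b k) :
    halfWidth i = 2 ^ k := by
  obtain ⟨t, -, rfl⟩ := Finset.mem_image.1 hi
  have e : b * 2 ^ L + 2 ^ k * (2 * t + 1) = 2 ^ k * (2 * (b * 2 ^ (L - 1 - k) + t) + 1) := by
    rw [two_pow_split hk]; ring
  rw [e, halfWidth_two_pow_mul_odd]

theorem bounds_of_mem_nodeClass {L b k i : ℕ} (hk : k < L) (hi : i ∈ nodeClass L b k) :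
    b * 2 ^ L + 2 ^ k ≤ i ∧ i + 2 ^ k ≤ (b + 1) * 2 ^ L := by
  obtain ⟨t, ht, rfl⟩ := Finset.mem_image.1 hi
  have ht' : t + 1 ≤ 2 ^ (L - 1 - k) := Finset.mem_range.1 ht
  have h1 : 2 ^ k * (2 * t + 1) = 2 ^ k * (2 * t) + 2 ^ k := by ring
  have h2 : 2 ^ k * (2 * (t + 1)) ≤ 2 ^ L := by
    rw [two_pow_split hk]; gcongr
  have h3 : 2 ^ k * (2 * (t + 1)) = 2 ^ k * (2 * t) + 2 ^ k + 2 ^ k := by ring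
  have h4 : (b + 1) * 2 ^ L = b * 2 ^ L + 2 ^ L := by ring
  constructor <;> omega

theorem isNodeClass_nodeClass {B L b k : ℕ} (hk : k < L) (hb : 1 ≤ b) (hb' : b < B) :
    IsNodeClass (B * 2 ^ L) (2 ^ k) (nodeClass L b k) where
  halfWidth_eq i hi := halfWidth_of_mem_nodeClass hk hi
  left_ne i hi := by
    have h1 := (bounds_of_mem_nodeClass hk hi).1
    have h2 : 0 < b * 2 ^ L := by positivity
    omega
  right_le i hi := (bounds_of_mem_nodeClass hk hi).2.trans (Nat.mul_le_mul_right _ hb')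

theorem nodeClass_disjoint (B L : ℕ) :
    ((Finset.Ico 1 B ×ˢ Finset.range L : Finset (ℕ × ℕ)) : Set (ℕ × ℕ)).PairwiseDisjoint
      fun t => nodeClass L t.1 t.2 := by
  rintro ⟨b, k⟩ ht ⟨b', k'⟩ ht' hne
  rw [Function.onFun, Finset.disjoint_left]
  intro i hi hi'
  simp only [Finset.coe_product, Finset.coe_Ico, Finset.coe_range, Set.mem_prod, Set.mem_Ico,
    Set.mem_Iio] at ht ht'
  have h1 := halfWidth_of_mem_nodeClass ht.2 hi
  have h2 := halfWidth_of_mem_nodeClass ht'.2 hi'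
  have h3 : b * 2 ^ L + 2 ^ k ≤ i ∧ i + 2 ^ k ≤ (b + 1) * 2 ^ L := bounds_of_mem_nodeClass ht.2 hi
  have h4 : b' * 2 ^ L + 2 ^ k' ≤ i ∧ i + 2 ^ k' ≤ (b' + 1) * 2 ^ L :=
    bounds_of_mem_nodeClass ht'.2 hi'
  have hk : k = k' := Nat.pow_right_injective le_rfl (h1.symm.trans h2)
  have hpos : 0 < 2 ^ k := by positivity
  have hpos' : 0 < 2 ^ k' := by positivity
  have b1 : b < b' + 1 := lt_of_mul_lt_mul_right (by omega : b * 2 ^ L < (b' + 1) * 2 ^ L) (by simp)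
  have b2 : b' < b + 1 := lt_of_mul_lt_mul_right (by omega : b' * 2 ^ L < (b + 1) * 2 ^ L) (by simp)
  exact hne (by rw [hk, show b = b' by omega])

/-- Reversing the jumps of one class makes the function far from convex. -/
theorem isFarFromConvex_hardInput {B L b k n l : ℕ} {T : ℤ} {ε : ℝ}
    (hT : 4 * (((B * 2 ^ L : ℕ) : ℤ) + 1) ^ 2 ≤ T) (hl : 17 ≤ l) (hk : k < L) (hb : 1 ≤ b)
    (hb' : b < B) (hε : 0 ≤ ε) (hεB : ε * B ≤ 4 / 9) (hn : B * 2 ^ L * l ≤ n)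
    (hn' : n ≤ (l + 1) * (B * 2 ^ L))
    {p : (Fin (B * 2 ^ L + 1) → ℤ) × (Fin (B * 2 ^ L + 1) → ℤ)} (hp : p ∈ paramBox (B * 2 ^ L) T) :
    IsFarFromConvex ε (hardInput n l (nodeClass L b k) p) := by
  intro g hg
  have hκ := isNodeClass_nodeClass hk hb hb'
  have h := le_ncard_disagreement hT (by omega : 0 < l) _ hp
    (fun i hi => ⟨hκ.ne_zero hi, hκ.right_le i hi, hκ.halfWidth_eq i hi⟩) hn hg
  rw [card_nodeClass] at h
  have hw : 0 < 2 ^ k := by positivity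
  have h1 : 2 ^ k * (l - 1) ≤ 2 ^ k * l - 1 := by
    rw [Nat.mul_sub, mul_one]
    omega
  have h2 := (Nat.mul_le_mul_left (2 ^ (L - 1 - k)) h1).trans h
  have h3 : (2 ^ L : ℕ) * (l - 1) ≤
      2 * {x : Fin n | hardFn l (nodeClass L b k) p.1 p.2 x ≠ g x}.ncard := by
    refine le_trans (le_of_eq ?_) (Nat.mul_le_mul_left 2 h2)
    rw [two_pow_split hk]
    ring
  have h4 : (2 : ℝ) ^ L * (l - 1) ≤
      2 * ({x : Fin n | hardFn l (nodeClass L b k) p.1 p.2 x ≠ g x}.ncard : ℝ) := by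
    have := (Nat.cast_le (α := ℝ)).2 h3
    rwa [Nat.cast_mul, Nat.cast_mul, Nat.cast_sub (by omega), Nat.cast_pow, Nat.cast_one,
      Nat.cast_ofNat] at this
  have h5 : (n : ℝ) ≤ (l + 1) * (B * 2 ^ L) := by exact_mod_cast hn'
  have hl' : (17 : ℝ) ≤ l := by exact_mod_cast hl
  have hL : (0 : ℝ) < 2 ^ L := by positivity
  have h6 : ε * n ≤ 4 / 9 * ((l + 1) * 2 ^ L) := by
    calc ε * n ≤ ε * ((l + 1) * (B * 2 ^ L)) := by gcongr
      _ = (ε * B) * ((l + 1) * 2 ^ L) := by ring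
      _ ≤ _ := by gcongr
  have h7 : 4 / 9 * (((l : ℝ) + 1) * 2 ^ L) ≤ 2 ^ L * (l - 1) / 2 := by nlinarith
  have : ε * n ≤ ({x : Fin n | hardFn l (nodeClass L b k) p.1 p.2 x ≠ g x}.ncard : ℝ) := by linarith
  exact this

/-! ### The boundary of the parameter box -/

theorem card_paramBox (M : ℕ) {T : ℤ} (hT : 1 ≤ T) :
    ((paramBox M T).card : ℝ) = (∏ i : Fin (M + 1), (T : ℝ) ^ (2 * padicValNat 2 i + 2)) *
      ∏ i : Fin (M + 1), (T : ℝ) ^ (2 * padicValNat 2 i + 1) := by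
  have hT0 : (0 : ℤ) ≤ T := by omega
  have cast_card : ∀ a b : ℤ, a ≤ b → ((Finset.Ico a b).card : ℝ) = (b : ℝ) - a := by
    intro a b h
    have : (((b - a).toNat : ℤ) : ℝ) = ((b - a : ℤ) : ℝ) := by rw [Int.toNat_of_nonneg (by omega)]
    rw [Int.card_Ico]
    push_cast at this ⊢
    exact_mod_cast this
  rw [paramBox, Finset.card_product, Fintype.card_piFinset, Fintype.card_piFinset]
  push_cast
  congr 1
  · refine Finset.prod_congr rfl fun i _ => ?_
    rw [shiftRange, cast_card _ _ (by positivity)]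
    push_cast; ring
  · refine Finset.prod_congr rfl fun i _ => ?_
    have : 0 ≤ T ^ (2 * padicValNat 2 i + 1) := by positivity
    rw [jumpRange, cast_card _ _ (by linarith)]
    push_cast; ring

/-- All but a small fraction of the parameter box stays clear of its boundary. -/
theorem card_sdiff_innerBox_le (M : ℕ) {T : ℤ} (hT : T = 1000 * ((M : ℤ) + 1) ^ 2) :
    ((paramBox M T \ innerBox M T).card : ℝ) ≤ (paramBox M T).card / 25 := by
  have hM : (0 : ℤ) ≤ M := Int.natCast_nonneg M
  have hT1 : 1 ≤ T := by rw [hT]; nlinarith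
  have hT0 : (0 : ℝ) < T := by exact_mod_cast hT1
  have hTR : (T : ℝ) = 1000 * ((M : ℝ) + 1) ^ 2 := by rw [hT]; push_cast; ring
  have hMR : (0 : ℝ) ≤ M := Nat.cast_nonneg M
  set r : ℝ := 1 - 16 * (M + 1) / T with hr
  have hfrac : 16 * ((M : ℝ) + 1) / T * (2 * (M + 1)) = 32 / 1000 := by
    rw [hTR]; field_simp; norm_num
  have hfrac1 : 16 * ((M : ℝ) + 1) / T ≤ 1 := by
    rw [div_le_one hT0, hTR]; nlinarith
  have hr0 : 0 ≤ r := by rw [hr]; linarith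
  have card_ge : ∀ a b : ℤ, (b : ℝ) - a ≤ ((Finset.Ico a b).card : ℝ) := by
    intro a b
    rw [Int.card_Ico]
    exact_mod_cast Int.self_le_toNat (b - a)
  have hbern : 1 - 32 / 1000 ≤ r ^ (2 * (M + 1)) := by
    have := one_add_mul_le_pow (a := -(16 * ((M : ℝ) + 1) / T)) (by linarith) (2 * (M + 1))
    push_cast at this
    rw [← sub_eq_add_neg, ← hr] at this
    linarith
  have hinner : (1 - 32 / 1000) * ((paramBox M T).card : ℝ) ≤ (innerBox M T).card := by
    refine (mul_le_mul_of_nonneg_right hbern (Nat.cast_nonneg _)).trans ?_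
    have hp : r ^ (M + 1) = ∏ _i : Fin (M + 1), r := by simp
    rw [card_paramBox M hT1, innerBox, Finset.card_product, Fintype.card_piFinset,
      Fintype.card_piFinset, two_mul, pow_add, mul_mul_mul_comm, hp, ← Finset.prod_mul_distrib,
      ← Finset.prod_mul_distrib]
    push_cast
    refine mul_le_mul ?_ ?_ (Finset.prod_nonneg fun i _ => by positivity)
      (Finset.prod_nonneg fun i _ => Nat.cast_nonneg _)
    · refine Finset.prod_le_prod (fun i _ => by positivity) fun i _ => le_trans (le_of_eq ?_)
        (card_ge _ _)
      push_cast
      rw [hr]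
      field_simp
      ring
    · refine Finset.prod_le_prod (fun i _ => by positivity) fun i _ => le_trans ?_ (card_ge _ _)
      have e : r * (T : ℝ) ^ (2 * padicValNat 2 i + 1) = (T : ℝ) ^ (2 * padicValNat 2 i + 1) -
          16 * (M + 1) * T ^ (2 * padicValNat 2 i) := by
        rw [hr]
        field_simp
        ring
      have : 0 ≤ ((M : ℝ) + 1) * (T : ℝ) ^ (2 * padicValNat 2 i) := by positivity
      rw [e]
      push_cast
      linarith
  rw [Finset.cast_card_sdiff (innerBox_subset hT1)]
  have := Nat.cast_nonneg (α := ℝ) (paramBox M T).card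
  linarith

/-! ### Averaging over inputs and seeds -/

open Classical in
theorem RandomizedQueryAlgorithm.integral_accept {n : ℕ} (A : RandomizedQueryAlgorithm n)
    (f : Fin n → ℝ) :
    letI := A.measurableSpace
    Integrable (fun ω => if (A.alg ω).run f = true then (1 : ℝ) else 0) A.law ∧
      ∫ ω, (if (A.alg ω).run f = true then (1 : ℝ) else 0) ∂A.law = A.prob f true := by
  let := A.measurableSpace
  have := A.isProbabilityMeasure
  have hm : MeasurableSet {ω | (A.alg ω).run f = true} :=
    A.measurable_run f (measurableSet_singleton true)
  have e : (fun ω => if (A.alg ω).run f = true then (1 : ℝ) else 0) =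
      Set.indicator {ω | (A.alg ω).run f = true} 1 := by
    funext ω
    simp [Set.indicator_apply]
  rw [e]
  refine ⟨(integrable_const (1 : ℝ)).indicator hm, ?_⟩
  rw [integral_indicator_one hm]
  rfl

theorem RandomizedQueryAlgorithm.prob_true_add_prob_false {n : ℕ} (A : RandomizedQueryAlgorithm n)
    (f : Fin n → ℝ) : A.prob f true + A.prob f false = 1 := by
  let := A.measurableSpace
  have := A.isProbabilityMeasure
  have hm : MeasurableSet {ω | (A.alg ω).run f = true} :=
    A.measurable_run f (measurableSet_singleton true)
  have e : {ω | (A.alg ω).run f = false} = {ω | (A.alg ω).run f = true}ᶜ := by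
    ext ω; simp
  have := probReal_add_probReal_compl (μ := A.law) hm
  unfold RandomizedQueryAlgorithm.prob
  rw [e]
  exact this

open Classical in
/-- A deterministic algorithm with at most `q` queries that accepts many convex inputs also accepts
many of the inputs with reversed jumps on a class, on average over the classes. -/
theorem card_mul_accept_le {n M l q : ℕ} {T : ℤ} (hT : 1 ≤ T) (hl : 0 < l) {ι : Type*}
    (K : Finset ι) (κ : ι → Finset ℕ) (w : ι → ℕ) (hκ : ∀ t ∈ K, IsNodeClass M (w t) (κ t))
    (hdisj : (K : Set ι).PairwiseDisjoint κ) (A : QueryAlgorithm n)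
    (hq : ∀ p ∈ paramBox M T, A.queryCount (hardInput n l ∅ p) ≤ q) :
    K.card * ((paramBox M T).filter fun p => A.run (hardInput n l ∅ p) = true).card ≤
      ∑ t ∈ K, ((paramBox M T).filter fun p => A.run (hardInput n l (κ t) p) = true).card +
      (3 * q * (paramBox M T).card + K.card * (paramBox M T \ innerBox M T).card) := by
  have hcaught : ∑ t ∈ K, ((paramBox M T).filter fun p =>
      ∃ i ∈ κ t, Caught (queriedBlocks l A p) i).card ≤ 3 * q * (paramBox M T).card := by
    have swap := Finset.sum_card_bipartiteAbove_eq_sum_card_bipartiteBelow (s := K)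
      (t := paramBox M T) fun t p => ∃ i ∈ κ t, Caught (queriedBlocks l A p) i
    unfold Finset.bipartiteAbove Finset.bipartiteBelow at swap
    rw [swap, mul_comm _ (paramBox M T).card, ← smul_eq_mul]
    refine Finset.sum_le_card_nsmul _ _ _ fun p hp => ?_
    refine (card_caught_classes_le K κ hdisj (fun t ht i hi => (hκ t ht).ne_zero hi) _).trans ?_
    exact Nat.mul_le_mul_left 3
      (Finset.card_image_le.trans ((A.card_querySet_le _).trans (hq p hp)))
  calc _ = ∑ t ∈ K, ((paramBox M T).filter fun p => A.run (hardInput n l ∅ p) = true).card := by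
        rw [Finset.sum_const, smul_eq_mul]
    _ ≤ ∑ t ∈ K, (((paramBox M T).filter fun p => A.run (hardInput n l (κ t) p) = true).card +
          ((paramBox M T).filter fun p => ∃ i ∈ κ t, Caught (queriedBlocks l A p) i).card +
          (paramBox M T \ innerBox M T).card) :=
        Finset.sum_le_sum fun t ht => card_accept_le hT hl (hκ t ht) A
    _ ≤ _ := by
        rw [Finset.sum_add_distrib, Finset.sum_add_distrib, Finset.sum_const, smul_eq_mul]
        omega

/-- A randomized algorithm with at most `q` queries on the convex hard inputs that accepts these with
probability at least `2 / 3` and rejects the others with probability at least `2 / 3` needs a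
number of queries proportional to the number of classes. -/
theorem card_classes_le {n M l q : ℕ} {T : ℤ} (hT : T = 1000 * ((M : ℤ) + 1) ^ 2) (hl : 0 < l)
    {ι : Type*} (K : Finset ι) (κ : ι → Finset ℕ) (w : ι → ℕ)
    (hκ : ∀ t ∈ K, IsNodeClass M (w t) (κ t)) (hdisj : (K : Set ι).PairwiseDisjoint κ)
    (A : RandomizedQueryAlgorithm n)
    (hq : ∀ p ∈ paramBox M T, ∀ ω, (A.alg ω).queryCount (hardInput n l ∅ p) ≤ q)
    (hyes : ∀ p ∈ paramBox M T, 2 / 3 ≤ A.prob (hardInput n l ∅ p) true)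
    (hno : ∀ t ∈ K, ∀ p ∈ paramBox M T, 2 / 3 ≤ A.prob (hardInput n l (κ t) p) false) :
    (22 / 75 : ℝ) * K.card ≤ 3 * q := by
  classical
  let := A.measurableSpace
  have := A.isProbabilityMeasure
  have hT1 : 1 ≤ T := by
    rw [hT]; nlinarith [Int.natCast_nonneg M]
  set P := paramBox M T with hP
  have hPpos : (0 : ℝ) < P.card := by
    have hT0 : (0 : ℝ) < T := by exact_mod_cast hT1
    rw [hP, card_paramBox M hT1]
    exact mul_pos (Finset.prod_pos fun i _ => by positivity)
      (Finset.prod_pos fun i _ => by positivity)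
  let φ : (Fin n → ℝ) → A.Seed → ℝ := fun f ω => if (A.alg ω).run f = true then 1 else 0
  have hφi : ∀ f, Integrable (φ f) A.law := fun f => (A.integral_accept f).1
  have hφ : ∀ f, ∫ ω, φ f ω ∂A.law = A.prob f true := fun f => (A.integral_accept f).2
  set C : ℝ := 3 * q * P.card + K.card * (P \ innerBox M T).card with hC
  have pointwise : ∀ ω, (K.card : ℝ) * ∑ p ∈ P, φ (hardInput n l ∅ p) ω ≤
      ∑ t ∈ K, ∑ p ∈ P, φ (hardInput n l (κ t) p) ω + C := by
    intro ω
    have h := card_mul_accept_le hT1 hl K κ w hκ hdisj (A.alg ω) (fun p hp => hq p hp ω)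
    have h' := (Nat.cast_le (α := ℝ)).2 h
    push_cast at h'
    simp only [φ, ← Finset.sum_boole] at h' ⊢
    exact h'
  have integrated : (K.card : ℝ) * ∑ p ∈ P, A.prob (hardInput n l ∅ p) true ≤
      ∑ t ∈ K, ∑ p ∈ P, A.prob (hardInput n l (κ t) p) true + C := by
    have i1 : Integrable (fun ω => (K.card : ℝ) * ∑ p ∈ P, φ (hardInput n l ∅ p) ω) A.law :=
      (integrable_finsetSum _ fun p _ => hφi _).const_mul _
    have i2 : Integrable (fun ω => ∑ t ∈ K, ∑ p ∈ P, φ (hardInput n l (κ t) p) ω) A.law :=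
      integrable_finsetSum _ fun t _ => integrable_finsetSum _ fun p _ => hφi _
    have h := integral_mono i1 (i2.add (integrable_const C)) pointwise
    simp only [Pi.add_apply] at h
    rw [integral_const_mul, integral_finsetSum _ fun p _ => hφi _,
      integral_add i2 (integrable_const C),
      integral_finsetSum _ fun t _ => integrable_finsetSum _ fun p _ => hφi _] at h
    simp only [integral_finsetSum _ fun p _ => hφi _, hφ, integral_const, probReal_univ,
      one_smul] at h
    exact h
  have lower : (P.card : ℝ) * (2 / 3) ≤ ∑ p ∈ P, A.prob (hardInput n l ∅ p) true := by
    rw [← nsmul_eq_mul]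
    exact Finset.card_nsmul_le_sum _ _ _ hyes
  have upper : ∑ t ∈ K, ∑ p ∈ P, A.prob (hardInput n l (κ t) p) true ≤
      K.card * (P.card * (1 / 3)) := by
    rw [← nsmul_eq_mul, ← nsmul_eq_mul]
    refine Finset.sum_le_card_nsmul _ _ _ fun t ht => Finset.sum_le_card_nsmul _ _ _ fun p hp => ?_
    have := hno t ht p hp
    have := A.prob_true_add_prob_false (hardInput n l (κ t) p)
    linarith
  have hbd := card_sdiff_innerBox_le M hT
  have hK : (0 : ℝ) ≤ K.card := Nat.cast_nonneg _
  have k1 := mul_le_mul_of_nonneg_left lower hK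
  have k2 := mul_le_mul_of_nonneg_left hbd hK
  have k3 : (22 / 75 : ℝ) * K.card * P.card ≤ 3 * q * P.card := by
    rw [hC] at integrated
    linarith
  exact le_of_mul_le_mul_right k3 hPpos

/-! ### The choice of the numbers of chunks and levels -/

/-- The lower bound for `B` chunks of `2 ^ L` blocks: there are `(B - 1) L` classes. -/
theorem chunks_mul_levels_le {n s B L q : ℕ} {ε : ℝ} (hs : B * 2 ^ L + 1 ≤ s) (hB : 1 ≤ B)
    (hε : 0 ≤ ε) (hεB : ε * B ≤ 4 / 9) (hn : s * (s + 17) ≤ n) (A : RandomizedQueryAlgorithm n)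
    (hA : IsConvexityTester ε s A) (hq : MakesAtMostQueries s A q) :
    (22 / 75 : ℝ) * ((B - 1 : ℕ) * L) ≤ 3 * q := by
  set M := B * 2 ^ L with hM
  have hMpos : 0 < M := by positivity
  set l := n / M with hl
  have hl17 : s + 17 ≤ l := by
    rw [hl, Nat.le_div_iff_mul_le hMpos]
    exact (by nlinarith : (s + 17) * M ≤ s * (s + 17)).trans hn
  have hl0 : 0 < l := by omega
  have hn1 : M * l ≤ n := Nat.mul_div_le n M
  have hn2 : n ≤ (l + 1) * M := by
    rw [mul_comm]
    exact (Nat.lt_mul_div_succ n hMpos).le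
  have hn3 : n ≤ (M + 1) * l := hn2.trans (by nlinarith)
  obtain ⟨T, hT⟩ : ∃ T : ℤ, T = 1000 * ((M : ℤ) + 1) ^ 2 := ⟨_, rfl⟩
  have hT4 : 4 * ((M : ℤ) + 1) ^ 2 ≤ T := by
    have := sq_nonneg ((M : ℤ) + 1)
    linarith
  have hnum : ∀ κ p, numDistinctDerivatives (hardInput n (M := M) l κ p) ≤ s := fun κ p =>
    (numDistinctDerivatives_hardFn_le hl0 hn3 κ p.1 p.2).trans hs
  have h := card_classes_le (n := n) hT hl0 (Finset.Ico 1 B ×ˢ Finset.range L)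
    (fun t => nodeClass L t.1 t.2) (fun t => 2 ^ t.2)
    (fun t ht => by
      obtain ⟨h1, h2⟩ := Finset.mem_product.1 ht
      rw [Finset.mem_Ico] at h1
      exact isNodeClass_nodeClass (Finset.mem_range.1 h2) h1.1 h1.2)
    (nodeClass_disjoint B L) A (fun p _ ω => hq _ (hnum ∅ p) ω)
    (fun p hp => (hA _ (hnum ∅ p)).1 (isConvexFn_hardFn hT4 hl0 hn3 hp))
    (fun t ht p hp => by
      obtain ⟨h1, h2⟩ := Finset.mem_product.1 ht
      rw [Finset.mem_Ico] at h1
      exact (hA _ (hnum _ p)).2 (isFarFromConvex_hardInput hT4 (by omega)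
        (Finset.mem_range.1 h2) h1.1 h1.2 hε hεB hn1 hn2 hp))
  rw [Finset.card_product, Nat.card_Ico, Finset.card_range] at h
  push_cast at h ⊢
  exact h

theorem theorem4 :
    ∃ c : ℝ, 0 < c ∧ ∃ s₀ : ℕ, ∀ s : ℕ, s₀ ≤ s →
      ∀ ε : ℝ, 1 / (s : ℝ) ≤ ε → ε ≤ 1 / 9 →
        ∃ n₀ : ℕ, ∀ n : ℕ, n₀ ≤ n → s ≤ n →
          ∀ A : RandomizedQueryAlgorithm n, IsConvexityTester ε s A →
            ∀ q : ℕ, MakesAtMostQueries s A q →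
              c * (Real.log (ε * (s : ℝ)) / ε) ≤ (q : ℝ) := by
  refine ⟨1 / 50, by norm_num, 1, fun s hs ε hε hε9 => ⟨s * (s + 17), fun n hn _ A hA q hq => ?_⟩⟩
  have hs0 : (0 : ℝ) < s := by exact_mod_cast hs
  have hε0 : 0 < ε := (by positivity : (0 : ℝ) < 1 / s).trans_le hε
  have hεs : 1 ≤ ε * s := by rwa [div_le_iff₀ hs0] at hε
  have hs9R : (9 : ℝ) ≤ s := by nlinarith
  have hs9 : 9 ≤ s := by exact_mod_cast hs9R
  -- `B` is as large as the distance `ε` of a reversed class from convexity allows.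
  set B := ⌊4 / (9 * ε)⌋₊ with hBdef
  have hx4 : 4 ≤ 4 / (9 * ε) := by
    rw [le_div_iff₀ (by positivity)]; linarith
  have hBle : (B : ℝ) ≤ 4 / (9 * ε) := Nat.floor_le (by positivity)
  have hBlt : 4 / (9 * ε) < B + 1 := Nat.lt_floor_add_one _
  have hB4 : 4 ≤ B := Nat.le_floor (by exact_mod_cast hx4)
  have hεB : ε * B ≤ 4 / 9 := by
    rw [le_div_iff₀ (by positivity)] at hBle
    linarith
  have hs1 : ((s - 1 : ℕ) : ℝ) = s - 1 := by
    rw [Nat.cast_sub (by omega)]; simp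
  -- `L` is as large as the number `s` of derivatives then allows.
  set L := Nat.log 2 ((s - 1) / B) with hLdef
  have hBs : B ≤ s - 1 := by
    have : (B : ℝ) ≤ ((s - 1 : ℕ) : ℝ) := by
      rw [hs1]
      have : ε * B ≤ ε * (s - 1) := by linarith
      exact le_of_mul_le_mul_left this hε0
    exact_mod_cast this
  have hdiv : 0 < (s - 1) / B := Nat.div_pos hBs (by omega)
  have hL1 : B * 2 ^ L + 1 ≤ s := by
    have h1 := Nat.pow_log_le_self 2 hdiv.ne'
    have h2 : B * 2 ^ L ≤ s - 1 := (Nat.mul_le_mul_left B h1).trans (Nat.mul_div_le (s - 1) B)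
    omega
  have hL2 : ε * s ≤ 2 ^ L := by
    have h1 : (s - 1) / B < 2 ^ (L + 1) := Nat.lt_pow_succ_log_self (by norm_num) _
    have h2 : s - 1 < 2 ^ (L + 1) * B := (Nat.div_lt_iff_lt_mul (by omega)).1 h1
    have h3 : (s : ℝ) - 1 < 2 ^ (L + 1) * B := by
      rw [← hs1]; exact_mod_cast h2
    rw [pow_succ] at h3
    have h4 : ε * ((s : ℝ) - 1) ≤ 2 ^ L * 2 * (ε * B) := by nlinarith
    have h5 : (2 : ℝ) ^ L * 2 * (ε * B) ≤ 2 ^ L * 2 * (4 / 9) := by gcongr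
    have h6 : ε * (8 / 9 * s) ≤ ε * ((s : ℝ) - 1) := by gcongr; linarith
    linarith
  have hlog : Real.log (ε * s) ≤ L := by
    have h1 := Real.log_le_log (by linarith) hL2
    rw [Real.log_pow] at h1
    have h2 : Real.log 2 ≤ 1 := by linarith [Real.log_two_lt_d9]
    nlinarith [Nat.cast_nonneg (α := ℝ) L]
  have h := chunks_mul_levels_le hL1 (by omega) hε0.le hεB hn A hA hq
  have hB1 : 2 / (9 * ε) ≤ ((B - 1 : ℕ) : ℝ) := by
    rw [Nat.cast_sub (by omega)]
    have : 2 / (9 * ε) = 4 / (9 * ε) / 2 := by ring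
    rw [this]
    push_cast
    linarith
  have hL0 : (0 : ℝ) ≤ L := Nat.cast_nonneg _
  have k1 : 2 / (9 * ε) * L ≤ ((B - 1 : ℕ) : ℝ) * L := mul_le_mul_of_nonneg_right hB1 hL0
  have k2 : 2 / (9 * ε) * L = 2 / 9 * (L / ε) := by field_simp
  have k3 : Real.log (ε * s) / ε ≤ L / ε := by gcongr
  have k4 : 0 ≤ (L : ℝ) / ε := by positivity
  linarith
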